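/- An allocation instance consists of $n\ge 1$ agents, a set $\mathcal M$ of $m$ indivisible items, entitlements $b_1,\dots,b_n>0$ with $\sum_i b_i=1$, and valuations $v_i:2^{\mathcal M}\to\mathbb R_{\ge 0}$. It is submodular if every $v_i$ is normalized ($v_i(\emptyset)=0$), monotone ($v_i(S)\le v_i(T)$ for $S\subseteq T$) and submodular ($v_i(S\cup T)+v_i(S\cap T)\le v_i(S)+v_i(T)$). Write $$MMS_i=\max_{(A_1,\dots,A_n)}\min_j v_i(A_j),\qquad APS_i=\min_{p}\ \max_{S\subseteq\mathcal M,\ \sum_{j\in S}p_j\le b_i} v_i(S),$$ where $(A_1,\dots,A_n)$ ranges over the partitions of $\mathcal M$ into $n$ (possibly empty) bundles and $p$ over the non-negative prices $(p_j)_{j\in\mathcal M}$ with $\sum_j p_j=1$ (and $APS_i=0$ if there are no items). An algorithm with value-query access receives $n$, $m$, the entitlements and a vector $(t_1,\dots,t_n)$ of real numbers, may query the values $v_i(S)$, and outputs an allocation $(A_1,\dots,A_n)$ of all items. Given ratios $\rho_i$ that may depend on the instance, it is a conditional $\rho$-APS (respectively $\rho$-MMS) algorithm for a class of instances if, for every instance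 in the class and every vector $(t_1,\dots,t_n)$, its output satisfies: for every agent $i$, if $t_i\le APS_i$ (respectively $t_i\le MMS_i$), then $v_i(A_i)\ge\rho_i\, t_i$. It runs in polynomial time if the number of elementary operations (arithmetic operations and comparisons of real numbers, operations on indices, value queries; each takes unit time) is bounded by a polynomial in $n$ and $m$, and if moreover, whenever all $b_i$, $t_i$ and $v_i(S)$ are rational numbers of bit length at most $L$, the total bit cost of the computation is bounded by a polynomial in $n$, $m$ and $L$. Theorem. 1. There is a polynomial-time conditional $\rho$-APS algorithm for submodular instances, where the ratio for agent $i$ is $\rho_i=\frac{1}{3-2b_i}$. 2. There are a constant $c>0$ and a polynomial-time conditional $\rho$-MMS algorithm for submodular instances with equal entitlements ($b_i=\frac1n$ for all $i$), with $\rho=\frac{10}{27}+\frac{c}{n}$ for every $n\ge1$. -/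

import Mathlib

/-! ## Allocation instances, submodular valuations, MMS and APS -/

namespace FairAllocation

/-- A normalized, monotone (hence non-negative), submodular valuation on bundles of `m` items. -/
structure IsSubmodularValuation {m : ℕ} (v : Finset (Fin m) → ℝ) : Prop where
  empty : v ∅ = 0
  mono : ∀ S T : Finset (Fin m), S ⊆ T → v S ≤ v T
  submodular : ∀ S T : Finset (Fin m), v (S ∪ T) + v (S ∩ T) ≤ v S + v T

/-- An allocation instance: `n` agents, `m` items, positive entitlements summing to one, and
a valuation function for every agent. -/
structure AllocationInstance where
  n : ℕ
  m : ℕ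
  b : Fin n → ℝ
  v : Fin n → Finset (Fin m) → ℝ
  b_pos : ∀ i, 0 < b i
  b_sum : ∑ i, b i = 1

/-- The bundle that agent `i` receives when item `j` is given to agent `A j`. -/
def bundle {n m : ℕ} (A : Fin m → Fin n) (i : Fin n) : Finset (Fin m) :=
  Finset.univ.filter fun j => A j = i

/-- The maximin share of a valuation `v` with respect to `n` agents: the maximum, over all
partitions of the items into `n` (possibly empty) bundles, of the minimum value of a bundle. -/
noncomputable def maximinShare (n : ℕ) {m : ℕ} (v : Finset (Fin m) → ℝ) : ℝ :=
  ⨆ A : Fin m → Fin n, ⨅ i : Fin n, v (bundle A i)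

/-- The AnyPrice share of a valuation `v` with entitlement `b`: the minimum, over all
non-negative item prices that sum up to one, of the maximum value of a bundle of price at
most `b`. -/
noncomputable def anyPriceShare {m : ℕ} (b : ℝ) (v : Finset (Fin m) → ℝ) : ℝ :=
  ⨅ p : {p : Fin m → ℝ // (∀ j, 0 ≤ p j) ∧ ∑ j, p j = 1},
    ⨆ S : {S : Finset (Fin m) // ∑ j ∈ S, p.1 j ≤ b}, v S.1

/-- The instances in which all valuations are submodular. -/
def submodularInstances : Set AllocationInstance :=
  {I | ∀ i, IsSubmodularValuation (I.v i)}

/-- The instances in which all agents have the same entitlement `1 / n`. -/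
def equalEntitlementInstances : Set AllocationInstance :=
  {I | ∀ i, I.b i = 1 / (I.n : ℝ)}

/-! ## Algorithms with value queries: a real random access machine with a value oracle

The memory consists of finitely many (per program) named variables and unbounded arrays, holding
either natural numbers (used for counting, indexing and describing bundles) or real numbers.
Real numbers can only be handled by the four arithmetic operations and by comparisons, and the
only real constants are natural numbers.  Natural numbers can only be added and subtracted.
The valuations are accessible through value queries only. -/

/-- The memory of the machine. -/
structure Store where
  natVar : ℕ → ℕ
  natArr : ℕ → ℕ → ℕ
  realVar : ℕ → ℝ
  realArr : ℕ → ℕ → ℝ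

/-- The arithmetic operations on reals. -/
inductive ArithOp
  | add
  | sub
  | mul
  | div

/-- The value of an arithmetic operation; a quotient with denominator zero is zero. -/
noncomputable def ArithOp.value : ArithOp → ℝ → ℝ → ℝ
  | .add, x, y => x + y
  | .sub, x, y => x - y
  | .mul, x, y => x * y
  | .div, x, y => x / y

/-- The elementary instructions. Variables and arrays are named by natural numbers. -/
inductive Instr
  /-- natural variable `x := k` -/
  | natConst (x k : ℕ)
  /-- natural variable `x := y + z` -/
  | natAdd (x y z : ℕ)
  /-- natural variable `x := y - z` (zero if `y < z`) -/
  | natSub (x y z : ℕ)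
  /-- natural variable `x := a[y]`, with `a` an array of naturals -/
  | natLoad (x a y : ℕ)
  /-- `a[y] := x`, with `a` an array of naturals -/
  | natStore (a y x : ℕ)
  /-- real variable `x := k` -/
  | realConst (x k : ℕ)
  /-- real variable `x := y op z` -/
  | realArith (op : ArithOp) (x y z : ℕ)
  /-- real variable `x := a[y]`, with `a` an array of reals and `y` a natural variable -/
  | realLoad (x a y : ℕ)
  /-- `a[y] := x`, with `a` an array of reals and `y` a natural variable -/
  | realStore (a y x : ℕ)
  /-- natural variable `x := 1` if the real variables satisfy `y ≤ z`, else `x := 0` -/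
  | realCompare (x y z : ℕ)
  /-- real variable `x :=` the answer to the value query for the agent in the natural variable
  `y` and the bundle of all items `j` with `a[j] ≠ 0`, with `a` an array of naturals -/
  | query (x y a : ℕ)

/-- A value oracle: agent and indicator of a bundle are mapped to the value of the bundle. -/
abbrev Oracle := ℕ → (ℕ → ℕ) → ℝ

/-- The effect of an elementary instruction on the memory. -/
noncomputable def Instr.apply (q : Oracle) : Instr → Store → Store
  | .natConst x k, s => { s with natVar := Function.update s.natVar x k }
  | .natAdd x y z, s =>
      { s with natVar := Function.update s.natVar x (s.natVar y + s.natVar z) }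
  | .natSub x y z, s =>
      { s with natVar := Function.update s.natVar x (s.natVar y - s.natVar z) }
  | .natLoad x a y, s =>
      { s with natVar := Function.update s.natVar x (s.natArr a (s.natVar y)) }
  | .natStore a y x, s =>
      let a' := Function.update (s.natArr a) (s.natVar y) (s.natVar x)
      { s with natArr := Function.update s.natArr a a' }
  | .realConst x k, s => { s with realVar := Function.update s.realVar x (k : ℝ) }
  | .realArith op x y z, s =>
      { s with realVar := Function.update s.realVar x (op.value (s.realVar y) (s.realVar z)) }
  | .realLoad x a y, s =>
      { s with realVar := Function.update s.realVar x (s.realArr a (s.natVar y)) }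
  | .realStore a y x, s =>
      let a' := Function.update (s.realArr a) (s.natVar y) (s.realVar x)
      { s with realArr := Function.update s.realArr a a' }
  | .realCompare x y z, s =>
      let r := if s.realVar y ≤ s.realVar z then 1 else 0
      { s with natVar := Function.update s.natVar x r }
  | .query x y a, s =>
      { s with realVar := Function.update s.realVar x (q (s.natVar y) (s.natArr a)) }

/-- The cost of an elementary instruction: one, plus the sizes (measured by `w`) of all real
numbers that the instruction reads or writes.  With `w = 0` every instruction, and in particular
every value query, takes unit time.  With `w` the bit length this is the logarithmic cost.
(Operations on natural numbers, which are only additions and subtractions, cost one.) -/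
noncomputable def Instr.cost (q : Oracle) (w : ℝ → ℕ) : Instr → Store → ℕ
  | .realConst _ k, _ => 1 + w (k : ℝ)
  | .realArith op _ y z, s =>
      1 + w (s.realVar y) + w (s.realVar z) + w (op.value (s.realVar y) (s.realVar z))
  | .realLoad _ a y, s => 1 + w (s.realArr a (s.natVar y))
  | .realStore _ _ x, s => 1 + w (s.realVar x)
  | .realCompare _ y z, s => 1 + w (s.realVar y) + w (s.realVar z)
  | .query _ y a, s => 1 + w (q (s.natVar y) (s.natArr a))
  | _, _ => 1

/-- Programs. A program is a finite object that does not depend on the instance. -/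
inductive Program
  | skip
  | instr (c : Instr)
  | seq (P Q : Program)
  /-- run `P` if the natural variable `x` is nonzero, and `Q` otherwise -/
  | cond (x : ℕ) (P Q : Program)
  /-- run `P` as long as the natural variable `x` is nonzero -/
  | loop (x : ℕ) (P : Program)

/-- `Runs q w P s k s'`: started with memory `s`, program `P` with oracle `q` halts with
memory `s'` after a computation of total cost `k`. -/
inductive Runs (q : Oracle) (w : ℝ → ℕ) : Program → Store → ℕ → Store → Prop
  | skip (s : Store) : Runs q w .skip s 1 s
  | instr (c : Instr) (s : Store) : Runs q w (.instr c) s (c.cost q w s) (c.apply q s)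
  | seq {P Q : Program} {s s' s'' : Store} {k l : ℕ}
      (hP : Runs q w P s k s') (hQ : Runs q w Q s' l s'') : Runs q w (.seq P Q) s (k + l) s''
  | condTrue {x : ℕ} {P Q : Program} {s s' : Store} {k : ℕ} (hx : s.natVar x ≠ 0)
      (hP : Runs q w P s k s') : Runs q w (.cond x P Q) s (1 + k) s'
  | condFalse {x : ℕ} {P Q : Program} {s s' : Store} {k : ℕ} (hx : s.natVar x = 0)
      (hQ : Runs q w Q s k s') : Runs q w (.cond x P Q) s (1 + k) s'
  | loopStop {x : ℕ} {P : Program} {s : Store} (hx : s.natVar x = 0) :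
      Runs q w (.loop x P) s 1 s
  | loopStep {x : ℕ} {P : Program} {s s' s'' : Store} {k l : ℕ} (hx : s.natVar x ≠ 0)
      (hP : Runs q w P s k s') (hL : Runs q w (.loop x P) s' l s'') :
      Runs q w (.loop x P) s (1 + k + l) s''

/-- The value oracle of an instance. -/
noncomputable def AllocationInstance.oracle (I : AllocationInstance) : Oracle := fun i f =>
  if h : i < I.n then I.v ⟨i, h⟩ (Finset.univ.filter fun j : Fin I.m => f j ≠ 0) else 0

/-- The initial memory: the natural variables 0 and 1 hold the numbers of agents and of items,
the real arrays 0 and 1 hold the entitlements and the vector `t`; all else is zero. -/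
noncomputable def AllocationInstance.input (I : AllocationInstance) (t : Fin I.n → ℝ) : Store where
  natVar x := if x = 0 then I.n else if x = 1 then I.m else 0
  natArr _ _ := 0
  realVar _ := 0
  realArr a i :=
    if h : i < I.n then (if a = 0 then I.b ⟨i, h⟩ else if a = 1 then t ⟨i, h⟩ else 0) else 0

/-- On the instance `I` with additional input `t`, program `P` halts and outputs the allocation
that gives item `j` to agent `A j`; the output is read off the array 0 of naturals. -/
def Outputs (P : Program) (I : AllocationInstance) (t : Fin I.n → ℝ)
    (A : Fin I.m → Fin I.n) : Prop :=
  ∃ (k : ℕ) (s : Store), Runs I.oracle 0 P (I.input t) k s ∧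
    ∀ j : Fin I.m, s.natArr 0 j = (A j : ℕ)

/-- The bit length of a rational number. -/
def ratBits (r : ℚ) : ℕ := Nat.size r.num.natAbs + Nat.size r.den

open Classical in
/-- The bit length of a real number that is rational (zero if it is irrational). -/
noncomputable def bitLength (x : ℝ) : ℕ :=
  if h : ∃ r : ℚ, (r : ℝ) = x then ratBits h.choose else 0

/-- `x` is a rational number of bit length at most `L`. -/
def IsRationalOfLength (L : ℕ) (x : ℝ) : Prop := ∃ r : ℚ, (r : ℝ) = x ∧ ratBits r ≤ L

/-- On every instance of the class `K`, with every additional input `t`, program `P` halts in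
polynomial time, in the following strong sense: the number of elementary instructions (including
the value queries) is bounded by a polynomial in the numbers `n` of agents and `m` of items; and
if entitlements, bundle values and the entries of `t` are rationals of bit length at most `L`,
then the total bit cost of the computation is bounded by a polynomial in `n`, `m` and `L`. -/
def RunsInPolynomialTime (P : Program) (K : Set AllocationInstance) : Prop :=
  (∃ T : Polynomial ℕ, ∀ I ∈ K, ∀ t : Fin I.n → ℝ,
    ∃ (k : ℕ) (s : Store), Runs I.oracle 0 P (I.input t) k s ∧ k ≤ T.eval (I.n + I.m)) ∧
  (∃ T : Polynomial ℕ, ∀ I ∈ K, ∀ (t : Fin I.n → ℝ) (L : ℕ),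
    (∀ i, IsRationalOfLength L (I.b i)) → (∀ i, IsRationalOfLength L (t i)) →
    (∀ i S, IsRationalOfLength L (I.v i S)) →
    ∃ (k : ℕ) (s : Store),
      Runs I.oracle bitLength P (I.input t) k s ∧ k ≤ T.eval (I.n + I.m + L))

/-- `P` is a conditional `ρ`-approximation algorithm with respect to `share` for the class `K`:
for every instance of `K` and every vector `t` it outputs an allocation in which every agent `i`
with `t i ≤ share i` gets a bundle of value at least `ρ i * t i`. -/
def IsConditionalAlgorithm (P : Program) (K : Set AllocationInstance)
    (share ρ : (I : AllocationInstance) → Fin I.n → ℝ) : Prop :=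
  ∀ I ∈ K, ∀ t : Fin I.n → ℝ, ∃ A : Fin I.m → Fin I.n, Outputs P I t A ∧
    ∀ i, t i ≤ share I i → ρ I i * t i ≤ I.v i (bundle A i)

end FairAllocation

/-! Both algorithms run the same auction. An agent is active while the value of the held bundle is
below a goal. In each round every active agent bids on every available item, the bid depending on
the marginal value of the item, and a highest bid wins and is paid. The bids are chosen so that two
properties hold together.

Budget: no agent ever pays more than a fixed budget, however ambitious the entry of `t` is
(`aps_payment_le`, `mms_payment_le`). Highest bids win, so large items are sold early and the last
purchase of an agent overshoots the goal only a little.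

Prices: an agent who misses the goal stays active, so all items are sold, and every item sold to
another agent cost at least the bid that this agent made for it at that time. Marginals decrease by
submodularity, so prices also dominate bids computed from the final marginals (`aps_price`,
`mms_price`). Bundles of high value are therefore expensive, which contradicts the budgets of the
others.

For the AnyPrice share, let `T = t / (3 - 2 * b)` be the goal and `b` the budget. A large first item
(value at least `T`) is bid at `b`, everything else at `b / (2 * T)` times its marginal. If the goal
is missed, the payments of the others total at most `1 - b`; normalized, they are a price vector for
which an affordable bundle costs at most `b * (1 - b)` before normalization. It then has value below
`T + 2 * T * (1 - b) = (3 - 2 * b) * T`, a contradiction.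

For the maximin share, values are scaled so that the share is at least `27`, and the goal is `ρ = 10
+ 1 / (10 * n)`. The budget is `14` up to a multiple of `ρ - 10`, and every bundle of value `27`
costs an agent's rivals at least `14` up to such a multiple (`mms_bundle_price`). The `n` bundles of
a maximin partition thus cost about `14 * n`, but only `n - 1` agents paid for them.

The machine program runs `m` rounds and queries values afresh each time. Every real number is
obtained from input data by boundedly many nested operations, so bit lengths grow only by a constant
factor (`Scale`, `scale_bitLength`). -/

namespace FairAllocation

/-! ## Marginal values of submodular valuations -/

/-- The marginal value of item `j` given the bundle `A`. -/
def marginal {m : ℕ} (v : Finset (Fin m) → ℝ) (A : Finset (Fin m)) (j : Fin m) : ℝ :=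
  v (insert j A) - v A

namespace IsSubmodularValuation

variable {m : ℕ} {v : Finset (Fin m) → ℝ}

theorem nonneg (hv : IsSubmodularValuation v) (S : Finset (Fin m)) : 0 ≤ v S := by
  have := hv.mono ∅ S (Finset.empty_subset S)
  rwa [hv.empty] at this

theorem marginal_nonneg (hv : IsSubmodularValuation v) (A : Finset (Fin m)) (j : Fin m) :
    0 ≤ marginal v A j :=
  sub_nonneg.2 (hv.mono _ _ (Finset.subset_insert j A))

theorem marginal_empty (hv : IsSubmodularValuation v) (j : Fin m) :
    marginal v ∅ j = v {j} := by
  simp [marginal, hv.empty]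

theorem marginal_anti (hv : IsSubmodularValuation v) {A B : Finset (Fin m)} (h : A ⊆ B)
    (j : Fin m) : marginal v B j ≤ marginal v A j := by
  by_cases hj : j ∈ B
  · have : marginal v B j = 0 := by simp [marginal, Finset.insert_eq_of_mem hj]
    rw [this]
    exact hv.marginal_nonneg A j
  · have h1 := hv.submodular (insert j A) B
    have h2 : insert j A ∪ B = insert j B := by
      rw [Finset.insert_union, Finset.union_eq_right.2 h]
    have h3 : insert j A ∩ B = A := by
      rw [Finset.insert_inter_of_notMem hj, Finset.inter_eq_left.2 h]
    rw [h2, h3] at h1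
    unfold marginal
    linarith

theorem marginal_le_singleton (hv : IsSubmodularValuation v) (A : Finset (Fin m)) (j : Fin m) :
    marginal v A j ≤ v {j} :=
  hv.marginal_empty j ▸ hv.marginal_anti (Finset.empty_subset A) j

theorem union_le (hv : IsSubmodularValuation v) (A S : Finset (Fin m)) :
    v (A ∪ S) ≤ v A + ∑ j ∈ S, marginal v A j := by
  induction S using Finset.induction_on with
  | empty => simp
  | insert j S hj ih =>
    rw [Finset.sum_insert hj, Finset.union_insert]
    have := hv.marginal_anti (A := A) (B := A ∪ S) Finset.subset_union_left j
    unfold marginal at this ⊢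
    unfold marginal at ih
    linarith

/-- Both guarantees use submodularity in this form, with `A` the final bundle of an unsatisfied
agent. -/
theorem le_add_sum (hv : IsSubmodularValuation v) (A S : Finset (Fin m)) :
    v S ≤ v A + ∑ j ∈ S, marginal v A j :=
  (hv.mono _ _ Finset.subset_union_right).trans (hv.union_le A S)

theorem const_mul (hv : IsSubmodularValuation v) {a : ℝ} (ha : 0 ≤ a) :
    IsSubmodularValuation fun S => a * v S where
  empty := by simp [hv.empty]
  mono S T h := mul_le_mul_of_nonneg_left (hv.mono S T h) ha
  submodular S T := by
    have := mul_le_mul_of_nonneg_left (hv.submodular S T) ha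
    linarith

end IsSubmodularValuation

/-! ## The sequential auction -/

section Auction

variable {n m : ℕ}

/-- The bundle held by agent `i` when `o` describes the owners of the items sold so far. -/
def held (o : Fin m → Option (Fin n)) (i : Fin n) : Finset (Fin m) :=
  Finset.univ.filter fun j => o j = some i

theorem mem_held {o : Fin m → Option (Fin n)} {i : Fin n} {j : Fin m} :
    j ∈ held o i ↔ o j = some i := by
  simp [held]

/-- Agent `i` still takes part in the auction and item `j` is still available. -/
def Candidate (act : Fin n → Finset (Fin m) → Prop) (o : Fin m → Option (Fin n))
    (i : Fin n) (j : Fin m) : Prop :=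
  act i (held o i) ∧ o j = none

/-- `Auction act bid k o π`: the owners `o` and the prices `π` can be the result of `k` rounds of
the auction in which in every round a highest bid for an available item is accepted. -/
inductive Auction (act : Fin n → Finset (Fin m) → Prop)
    (bid : Fin n → Finset (Fin m) → Fin m → ℝ) :
    ℕ → (Fin m → Option (Fin n)) → (Fin m → ℝ) → Prop
  | start : Auction act bid 0 (fun _ => none) (fun _ => 0)
  -- Idle rounds pad every run to exactly `m` rounds, the number that the program performs.
  | idle {k : ℕ} {o : Fin m → Option (Fin n)} {π : Fin m → ℝ} (h : Auction act bid k o π)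
      (hc : ∀ i j, ¬ Candidate act o i j) : Auction act bid (k + 1) o π
  | sell {k : ℕ} {o : Fin m → Option (Fin n)} {π : Fin m → ℝ} (h : Auction act bid k o π)
      (i : Fin n) (j : Fin m) (hc : Candidate act o i j)
      (hmax : ∀ i' j', Candidate act o i' j' →
        bid i' (held o i') j' ≤ bid i (held o i) j) :
      Auction act bid (k + 1) (Function.update o j (some i))
        (Function.update π j (bid i (held o i) j))

theorem held_update_self {o : Fin m → Option (Fin n)} {j : Fin m} (i : Fin n) :
    held (Function.update o j (some i)) i = insert j (held o i) := by
  ext k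
  rw [Finset.mem_insert, mem_held, mem_held]
  by_cases h : k = j
  · subst h; simp
  · simp [h]

theorem held_update_of_ne {o : Fin m → Option (Fin n)} {j : Fin m} (hj : o j = none)
    {i i' : Fin n} (h : i' ≠ i) : held (Function.update o j (some i)) i' = held o i' := by
  ext k
  rw [mem_held, mem_held]
  by_cases hk : k = j
  · subst hk; simp [hj, Ne.symm h]
  · simp [hk]

theorem held_subset_update {o : Fin m → Option (Fin n)} {j : Fin m} (hj : o j = none)
    (i i' : Fin n) : held o i' ⊆ held (Function.update o j (some i)) i' := by
  by_cases h : i' = i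
  · subst h; rw [held_update_self]; exact Finset.subset_insert _ _
  · rw [held_update_of_ne hj h]

variable {act : Fin n → Finset (Fin m) → Prop} {bid : Fin n → Finset (Fin m) → Fin m → ℝ}
  {k : ℕ} {o : Fin m → Option (Fin n)} {π : Fin m → ℝ}

/-- A round without a sale leaves the state unchanged, so all later rounds are idle too; until then
every round sells a new item. -/
theorem Auction.no_candidate_or_card_le (h : Auction act bid k o π) :
    (∀ i j, ¬ Candidate act o i j) ∨ k ≤ (Finset.univ.filter fun j => o j ≠ none).card := by
  induction h with
  | start => right; simp
  | idle _ hc _ => exact Or.inl hc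
  | @sell k o π h i j hc _ ih =>
    right
    have hk := ih.resolve_left (fun h => h i j hc)
    have : (Finset.univ.filter fun l => Function.update o j (some i) l ≠ none) =
        insert j (Finset.univ.filter fun l => o l ≠ none) := by
      ext l
      by_cases hl : l = j
      · subst hl; simp
      · simp [hl]
    rw [this, Finset.card_insert_of_notMem (by simp [hc.2])]
    omega

/-- After as many rounds as there are items, no active agent is left or all items are sold. -/
theorem Auction.no_candidate (h : Auction act bid m o π) (i : Fin n) (j : Fin m) :
    ¬ Candidate act o i j := by
  rcases h.no_candidate_or_card_le with h1 | h1
  · exact h1 i j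
  · intro hc
    have h2 : (Finset.univ.filter fun j => o j ≠ none) = Finset.univ := by
      rw [← Finset.card_eq_iff_eq_univ]
      refine le_antisymm (Finset.card_le_univ _) ?_
      simpa using h1
    have := Finset.mem_univ j
    rw [← h2] at this
    simp [hc.2] at this

theorem sum_held_update_of_ne {j : Fin m} (hj : o j = none) {i i' : Fin n} (h : i' ≠ i) (p : ℝ) :
    ∑ l ∈ held (Function.update o j (some i)) i', Function.update π j p l =
      ∑ l ∈ held o i', π l := by
  rw [held_update_of_ne hj h]
  refine Finset.sum_congr rfl fun l hl => ?_
  rw [Function.update_of_ne]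
  rintro rfl
  rw [mem_held, hj] at hl
  cases hl

theorem sum_held_update_self {j : Fin m} (hj : o j = none) (i : Fin n) (p : ℝ) :
    ∑ l ∈ held (Function.update o j (some i)) i, Function.update π j p l =
      ∑ l ∈ held o i, π l + p := by
  have hj' : j ∉ held o i := by simp [mem_held, hj]
  rw [held_update_self, Finset.sum_insert hj', Function.update_self, add_comm]
  congr 1
  refine Finset.sum_congr rfl fun l hl => ?_
  rw [Function.update_of_ne]
  rintro rfl
  exact hj' hl

/-- Disposes of agents whose goal is not positive: they never take part and pay nothing. -/
theorem Auction.held_eq_empty (h : Auction act bid k o π) {i : Fin n} (hi : ∀ A, ¬ act i A) :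
    held o i = ∅ := by
  induction h with
  | start => simp [held]
  | idle _ _ ih => exact ih
  | @sell k o π h i' j hc _ ih =>
    have hne : i ≠ i' := by rintro rfl; exact hi _ hc.1
    rw [held_update_of_ne hc.2 hne, ih]

/-- If all items are sold, then the payments of the agents other than `i` are the prices of the
items that are not held by `i`. -/
theorem sum_prices_eq (ho : ∀ j, o j ≠ none) (i : Fin n) :
    ∑ j, (if o j = some i then 0 else π j) =
      ∑ k ∈ Finset.univ.erase i, ∑ j ∈ held o k, π j := by
  have h1 : ∀ k, ∑ j ∈ held o k, π j = ∑ j, if o j = some k then π j else 0 := by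
    intro k
    rw [held, Finset.sum_filter]
  simp_rw [h1]
  rw [Finset.sum_comm]
  refine Finset.sum_congr rfl fun j _ => ?_
  obtain ⟨k, hk⟩ := Option.ne_none_iff_exists'.1 (ho j)
  simp only [hk, Option.some.injEq]
  by_cases hki : k = i
  · subst hki
    rw [if_pos rfl]
    refine (Finset.sum_eq_zero fun l hl => ?_).symm
    rw [if_neg]
    exact fun h => (Finset.ne_of_mem_erase hl) h.symm
  · rw [if_neg hki, Finset.sum_ite_eq, if_pos]
    simp [hki]

theorem sum_prices_le (ho : ∀ j, o j ≠ none) (i : Fin n) (β : Fin n → ℝ)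
    (hβ : ∀ k, ∑ j ∈ held o k, π j ≤ β k) :
    ∑ j, (if o j = some i then 0 else π j) ≤ ∑ k ∈ Finset.univ.erase i, β k := by
  rw [sum_prices_eq ho]
  exact Finset.sum_le_sum fun k _ => hβ k

end Auction

/-! ## Bidding for the AnyPrice share -/

/-- The bid of an agent with entitlement `b` and goal `T` who holds `c` items, for an item of
marginal value `y`. -/
noncomputable def apsBid (b T : ℝ) (c : ℕ) (y : ℝ) : ℝ :=
  -- The rate `b / (2 * T)` lets the value reach `2 * T` within the budget `b`: below `T` before the
  -- last purchase, plus a marginal below `T`.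
  if c = 0 ∧ T ≤ y then b else b / (2 * T) * y

section APS

variable {n m : ℕ} {act : Fin n → Finset (Fin m) → Prop}
  {bid : Fin n → Finset (Fin m) → Fin m → ℝ} {k : ℕ} {o : Fin m → Option (Fin n)}
  {π : Fin m → ℝ} {i : Fin n} {v : Finset (Fin m) → ℝ} {b T : ℝ}

/-- The last clause is what bounds the overshoot: an agent whose first purchase was a small item did
not see any large one, for a large one would have drawn the higher bid `b`. -/
theorem Auction.aps_spending (h : Auction act bid k o π) (hv : IsSubmodularValuation v)
    (hb : 0 < b) (hT : 0 < T) (hact : ∀ A, act i A ↔ v A < T)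
    (hbid : ∀ A j, bid i A j = apsBid b T A.card (marginal v A j)) :
    held o i = ∅ ∨ (T ≤ v (held o i) ∧ ∑ j ∈ held o i, π j ≤ b) ∨
      (held o i ≠ ∅ ∧ v (held o i) < T ∧ ∑ j ∈ held o i, π j = b / (2 * T) * v (held o i) ∧
        ∀ j, o j = none → v {j} < T) := by
  induction h with
  | start => left; simp [held]
  | idle _ _ ih => exact ih
  | @sell k o π h i' j hc hmax ih =>
    by_cases hi : i = i'
    · subst hi
      have hx := (hact _).1 hc.1
      have hb2 : b / (2 * T) * (2 * T) = b := by field_simp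
      have hα : 0 < b / (2 * T) := by positivity
      rw [sum_held_update_self hc.2, hbid]
      rcases ih with h0 | h1 | h2
      · rw [held_update_self, h0]
        simp only [Finset.sum_empty, zero_add, Finset.card_empty, hv.marginal_empty, apsBid,
          insert_empty_eq, true_and]
        right
        by_cases hy : T ≤ v {j}
        · left; exact ⟨hy, by rw [if_pos hy]⟩
        · right
          rw [if_neg hy]
          refine ⟨by simp, not_le.1 hy, rfl, fun j' hj' => ?_⟩
          have hj0 : o j' = none := by
            by_contra hne
            rw [Function.update_apply] at hj'
            split_ifs at hj'
            exact hne hj'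
          -- An available large item would have drawn the bid `b`, while the winning bid for `j` is
          -- below `b / 2`.
          by_contra hlt
          have := hmax i j' ⟨hc.1, hj0⟩
          rw [h0, hbid, hbid, apsBid, apsBid, Finset.card_empty, hv.marginal_empty,
            hv.marginal_empty, if_pos ⟨rfl, not_lt.1 hlt⟩, if_neg (by simpa using hy)] at this
          nlinarith
      · linarith [h1.1]
      · right
        obtain ⟨hne, -, hs, hsmall⟩ := h2
        have hcard : (held o i).card ≠ 0 := by simpa using hne
        have hbd : apsBid b T (held o i).card (marginal v (held o i) j) =
            b / (2 * T) * marginal v (held o i) j := by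
          rw [apsBid, if_neg (by tauto)]
        rw [hbd, hs, held_update_self, ← mul_add]
        have hadd : v (held o i) + marginal v (held o i) j = v (insert j (held o i)) := by
          simp [marginal]
        rw [hadd]
        by_cases hT' : T ≤ v (insert j (held o i))
        · left
          refine ⟨hT', ?_⟩
          -- The value held before and the new marginal are both below `T`, so the total payment is
          -- below `b / (2 * T) * (2 * T) = b`.
          have := hv.marginal_le_singleton (held o i) j
          have := hsmall j hc.2
          nlinarith
        · right
          refine ⟨Finset.insert_ne_empty _ _, not_le.1 hT', rfl, fun j' hj' => hsmall j' ?_⟩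
          by_contra hne
          rw [Function.update_apply] at hj'
          split_ifs at hj'
          exact hne hj'
    · rw [sum_held_update_of_ne hc.2 hi, held_update_of_ne hc.2 hi]
      refine ih.imp id (Or.imp id fun ⟨h1, h2, h3, h4⟩ => ⟨h1, h2, h3, fun j' hj' => h4 j' ?_⟩)
      by_contra hne
      rw [Function.update_apply] at hj'
      split_ifs at hj'
      exact hne hj'

/-- No relation between `T` and the share is needed, so agents with an unattainable goal cannot harm
the others. -/
theorem Auction.aps_payment_le (h : Auction act bid k o π) (hv : IsSubmodularValuation v)
    (hb : 0 < b) (hact : ∀ A, act i A ↔ v A < T)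
    (hbid : ∀ A j, bid i A j = apsBid b T A.card (marginal v A j)) :
    ∑ j ∈ held o i, π j ≤ b := by
  rcases le_or_gt T 0 with hT | hT
  · rw [h.held_eq_empty fun A hA => ?_]
    · simpa using hb.le
    · linarith [(hact A).1 hA, hv.nonneg A]
  · rcases h.aps_spending hv hb hT hact hbid with h1 | h1 | ⟨-, h1, h2, -⟩
    · rw [h1]; simpa using hb.le
    · exact h1.2
    · rw [h2]
      have hα : 0 < b / (2 * T) := by positivity
      have hb2 : b / (2 * T) * (2 * T) = b := by field_simp
      nlinarith

/-- Agent `i` was active when `j` was sold and was outbid, so the price is at least the bid of `i`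
at that time; later purchases of `i` only lower the marginal. -/
theorem Auction.aps_price (h : Auction act bid k o π) (hv : IsSubmodularValuation v)
    (hb : 0 < b) (hT : 0 < T) (hact : ∀ A, act i A ↔ v A < T)
    (hbid : ∀ A j, bid i A j = apsBid b T A.card (marginal v A j)) (hi : v (held o i) < T)
    (j : Fin m) (hj : o j ≠ none) (hji : o j ≠ some i) :
    0 ≤ π j ∧ (T ≤ v {j} → b ≤ π j) ∧
      (v {j} < T → b / (2 * T) * marginal v (held o i) j ≤ π j) := by
  have hα : 0 < b / (2 * T) := by positivity
  induction h with
  | start => exact absurd rfl hj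
  | idle _ _ ih => exact ih hi hj hji
  | @sell k o π h i' j' hc hmax ih =>
    have hsub := held_subset_update hc.2 i' i
    have hi0 : v (held o i) < T := (hv.mono _ _ hsub).trans_lt hi
    by_cases hjj : j = j'
    · subst hjj
      have hne : i ≠ i' := by rintro rfl; simp at hji
      have hm := hmax i j ⟨(hact _).2 hi0, hc.2⟩
      rw [held_update_of_ne hc.2 hne, Function.update_self]
      have hn := hv.marginal_nonneg (held o i) j
      have hn' : 0 ≤ b / (2 * T) * marginal v (held o i) j := by positivity
      have hle := hv.marginal_le_singleton (held o i) j
      rw [hbid] at hm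
      unfold apsBid at hm
      refine ⟨?_, fun hl => ?_, fun hl => ?_⟩
      · split_ifs at hm <;> linarith
      -- A large item is bid at `b` only while nothing is held; the spending invariant excludes that
      -- an unsatisfied agent with items still sees a large one.
      · rcases h.aps_spending hv hb hT hact hbid with h1 | h1 | ⟨-, h1, h2, h3⟩
        · rw [h1, hv.marginal_empty, if_pos ⟨rfl, hl⟩] at hm
          exact hm
        · linarith [h1.1]
        · linarith [h3 j hc.2]
      · rw [if_neg (fun hh => by linarith [hh.2])] at hm
        exact hm
    · rw [Function.update_of_ne hjj] at hj hji ⊢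
      obtain ⟨h0, h1, h2⟩ := ih hi0 hj hji
      refine ⟨h0, h1, fun hl => le_trans ?_ (h2 hl)⟩
      exact mul_le_mul_of_nonneg_left (hv.marginal_anti hsub j) hα.le

/-- A single price vector bounds the infimum. The inner supremum is over a finite set, hence
attained, which keeps the inequality strict. -/
theorem anyPriceShare_le_of_forall {p : Fin m → ℝ} (hv : IsSubmodularValuation v) (hb : 0 ≤ b)
    (hp : ∀ j, 0 ≤ p j) (hp1 : ∑ j, p j = 1) {x : ℝ}
    (hx : ∀ S : Finset (Fin m), ∑ j ∈ S, p j ≤ b → v S < x) : anyPriceShare b v < x := by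
  let q : {p : Fin m → ℝ // (∀ j, 0 ≤ p j) ∧ ∑ j, p j = 1} := ⟨p, hp, hp1⟩
  have key : ∀ r : {p : Fin m → ℝ // (∀ j, 0 ≤ p j) ∧ ∑ j, p j = 1},
      0 ≤ ⨆ S : {S : Finset (Fin m) // ∑ j ∈ S, r.1 j ≤ b}, v S.1 :=
    fun r => Real.iSup_nonneg fun S => hv.nonneg _
  have h1 : anyPriceShare b v ≤ ⨆ S : {S : Finset (Fin m) // ∑ j ∈ S, q.1 j ≤ b}, v S.1 :=
    ciInf_le ⟨0, by rintro _ ⟨r, rfl⟩; exact key r⟩ q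
  refine h1.trans_lt ?_
  have : Nonempty {S : Finset (Fin m) // ∑ j ∈ S, q.1 j ≤ b} := ⟨∅, by simpa using hb⟩
  obtain ⟨S, hS⟩ := exists_eq_ciSup_of_finite
    (f := fun S : {S : Finset (Fin m) // ∑ j ∈ S, q.1 j ≤ b} => v S.1)
  rw [← hS]
  exact hx S.1 S.2

theorem anyPriceShare_le_univ (hv : IsSubmodularValuation v) (hb : 0 ≤ b) :
    anyPriceShare b v ≤ v Finset.univ := by
  rcases Nat.eq_zero_or_pos m with rfl | hm
  · have : IsEmpty {p : Fin 0 → ℝ // (∀ j, 0 ≤ p j) ∧ ∑ j, p j = 1} :=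
      ⟨fun p => by simpa using p.2.2⟩
    rw [anyPriceShare, Real.iInf_of_isEmpty]
    exact hv.nonneg _
  · refine le_of_forall_gt fun x hx => ?_
    refine anyPriceShare_le_of_forall (p := fun _ => (1 : ℝ) / m) hv hb
      (fun _ => by positivity) ?_ fun S _ => (hv.mono _ _ (Finset.subset_univ S)).trans_lt hx
    have : (m : ℝ) ≠ 0 := by positivity
    simp [this]

/-- An agent whose goal is `t / (3 - 2 b)` for some `t` up to the AnyPrice share reaches it,
provided the payments of every other agent do not exceed the entitlement. -/
theorem Auction.aps_guarantee (h : Auction act bid m o π) (hv : IsSubmodularValuation v)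
    (hb : 0 < b) (hb1 : b ≤ 1) (hact : ∀ A, act i A ↔ v A < T)
    (hbid : ∀ A j, bid i A j = apsBid b T A.card (marginal v A j)) {β : Fin n → ℝ}
    (hβ : ∀ k, ∑ j ∈ held o k, π j ≤ β k) (hβ1 : ∑ k ∈ Finset.univ.erase i, β k ≤ 1 - b)
    (hT : (3 - 2 * b) * T ≤ anyPriceShare b v) : T ≤ v (held o i) := by
  by_contra hlt
  rw [not_le] at hlt
  have hT0 : 0 < T := (hv.nonneg _).trans_lt hlt
  have ho : ∀ j, o j ≠ none := fun j hj => h.no_candidate i j ⟨(hact _).2 hlt, hj⟩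
  -- The agent's own items can be free because their marginals vanish; the sum of `q` is then what
  -- the others paid.
  set q : Fin m → ℝ := fun j => if o j = some i then 0 else π j with hq
  have hQ : ∑ j, q j ≤ 1 - b := (sum_prices_le ho i β hβ).trans hβ1
  have hα : 0 < b / (2 * T) := by positivity
  have hprice := fun j => h.aps_price hv hb hT0 hact hbid hlt j (ho j)
  have hq0 : ∀ j, 0 ≤ q j := by
    intro j
    by_cases hji : o j = some i
    · simp [hq, hji]
    · simpa [hq, hji] using (hprice j hji).1
  have hqm : ∀ j, v {j} < T → b / (2 * T) * marginal v (held o i) j ≤ q j := by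
    intro j hj
    by_cases hji : o j = some i
    · simp [hq, hji, marginal, Finset.insert_eq_of_mem (mem_held.2 hji)]
    · simpa [hq, hji] using (hprice j hji).2.2 hj
  have hqb : ∀ j, T ≤ v {j} → b ≤ q j := by
    intro j hj
    have hji : o j ≠ some i := by
      intro hji
      have := hv.mono {j} (held o i) (by simpa using mem_held.2 hji)
      linarith
    simpa [hq, hji] using (hprice j hji).2.1 hj
  have hlt' : v (held o i) < anyPriceShare b v := by nlinarith
  set Q := ∑ j, q j with hQdef
  have hQ0 : 0 ≤ Q := Finset.sum_nonneg fun j _ => hq0 j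
  -- A bundle cheaper than `b` contains no large item, so the linear price bound applies to each of
  -- its items.
  have hval : ∀ S : Finset (Fin m), (∑ j ∈ S, q j < b) →
      b / (2 * T) * v S ≤ b / (2 * T) * v (held o i) + ∑ j ∈ S, q j := by
    intro S hS
    have h1 := hv.le_add_sum (held o i) S
    have h2 : b / (2 * T) * ∑ j ∈ S, marginal v (held o i) j ≤ ∑ j ∈ S, q j := by
      rw [Finset.mul_sum]
      refine Finset.sum_le_sum fun j hj => hqm j ?_
      by_contra hjT
      have := Finset.single_le_sum (f := q) (fun j _ => hq0 j) hj
      linarith [hqb j (not_lt.1 hjT)]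
    nlinarith
  -- If all prices vanish they cannot be normalized, but then the agent already holds the value of
  -- the whole item set.
  rcases hQ0.eq_or_lt with hQe | hQp
  · have h1 := hval Finset.univ (by rw [← hQdef, ← hQe]; exact hb)
    rw [← hQdef, ← hQe, add_zero] at h1
    have h2 := le_of_mul_le_mul_left h1 hα
    linarith [anyPriceShare_le_univ hv hb.le]
  · refine lt_irrefl _ (anyPriceShare_le_of_forall (p := fun j => q j / Q) hv hb.le
      (fun j => div_nonneg (hq0 j) hQ0) ?_ fun S hS => ?_)
    · rw [← Finset.sum_div, div_self hQp.ne']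
    · rw [← Finset.sum_div, div_le_iff₀ hQp] at hS
      -- Since `b * (1 - b) < b`, the estimate `hval` applies and gives `v S ≤ v (held o i) + 2 * T
      -- * (1 - b) < (3 - 2 * b) * T`.
      have hS' : ∑ j ∈ S, q j ≤ b * (1 - b) := hS.trans (mul_le_mul_of_nonneg_left hQ hb.le)
      have h1 := hval S (by nlinarith)
      have h2 : b / (2 * T) * (v S - v (held o i)) ≤ b / (2 * T) * (2 * T * (1 - b)) := by
        have : b / (2 * T) * (2 * T * (1 - b)) = b * (1 - b) := by field_simp
        rw [this]; linarith
      have h3 := le_of_mul_le_mul_left h2 hα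
      nlinarith

end APS

/-! ## Bidding for the maximin share -/

/-- The bid of an agent with goal `ρ` who holds `c` items of total value `x`, for an item of
marginal value `y`; values are scaled so that the maximin share is `27`. -/
noncomputable def mmsBid (ρ : ℝ) (c : ℕ) (x y : ℝ) : ℝ :=
  -- At `ρ = 10` the budget `7 / 4 * ρ - 7 / 2` equals `14`. A large first item uses it up; the caps
  -- `7` and `7 / 2` are a half and a quarter of it.
  if c = 0 ∧ ρ ≤ y then 14
  else if 2 ≤ c ∧ 28 / 3 ≤ x then min (7 / 4 * y) (7 / 2) else min y 7

/-- The agent holds so much that little is missing, and the bids are computed by the second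
rule. -/
def LateStage (c : ℕ) (x : ℝ) : Prop := 2 ≤ c ∧ 28 / 3 ≤ x

theorem LateStage.mono {c c' : ℕ} {x x' : ℝ} (h : LateStage c x) (hc : c ≤ c') (hx : x ≤ x') :
    LateStage c' x' :=
  ⟨h.1.trans hc, h.2.trans hx⟩

theorem mmsBid_large {ρ x y : ℝ} (h : ρ ≤ y) : mmsBid ρ 0 x y = 14 := by
  rw [mmsBid, if_pos ⟨rfl, h⟩]

theorem mmsBid_late {ρ x y : ℝ} {c : ℕ} (h : LateStage c x) :
    mmsBid ρ c x y = min (7 / 4 * y) (7 / 2) := by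
  have h1 : ¬ (c = 0 ∧ ρ ≤ y) := fun h' => by have := h.1; omega
  rw [mmsBid, if_neg h1]
  exact if_pos h

theorem mmsBid_early {ρ x y : ℝ} {c : ℕ} (h : ¬ LateStage c x) (hy : c = 0 → y < ρ) :
    mmsBid ρ c x y = min y 7 := by
  have h1 : ¬ (c = 0 ∧ ρ ≤ y) := fun h' => (hy h'.1).not_ge h'.2
  rw [mmsBid, if_neg h1]
  exact if_neg h

theorem le_mmsBid_early {ρ x y : ℝ} {c : ℕ} (h : ¬ LateStage c x) :
    min y 7 ≤ mmsBid ρ c x y := by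
  by_cases hy : c = 0 ∧ ρ ≤ y
  · rw [mmsBid, if_pos hy]
    exact (min_le_right _ _).trans (by norm_num)
  · rw [mmsBid_early h (by intro hc; by_contra hl; exact hy ⟨hc, not_lt.1 hl⟩)]

/-- If every item `j` has a weight `w j` such that its price `π j` is at least `h * w j`, and falls
short of `β * y j` by at most `γ * w j`, then the total price is at least the minimum of two
bounds. -/
theorem le_sum_of_weights {ι : Type*} (S : Finset ι) {π y : ι → ℝ} {h β γ Y : ℝ} (K : ℕ)
    (hh : 0 ≤ h) (hβ : 0 ≤ β) (hγ : 0 ≤ γ) (hY : Y ≤ ∑ j ∈ S, y j)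
    (hw : ∀ j ∈ S, ∃ w : ℕ, h * w ≤ π j ∧ β * y j - π j ≤ γ * w) :
    min (h * (K + 1)) (β * Y - γ * K) ≤ ∑ j ∈ S, π j := by
  choose! w hw1 hw2 using hw
  -- More than `K` units of weight already cost `h * (K + 1)`; at most `K` units cause a total
  -- shortfall of at most `γ * K`.
  rcases Nat.lt_or_ge K (∑ j ∈ S, w j) with hK | hK
  · refine (min_le_left _ _).trans ?_
    calc h * (K + 1) ≤ h * ∑ j ∈ S, (w j : ℝ) := by
          refine mul_le_mul_of_nonneg_left ?_ hh
          exact_mod_cast hK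
      _ = ∑ j ∈ S, h * w j := Finset.mul_sum _ _ _
      _ ≤ _ := Finset.sum_le_sum hw1
  · refine (min_le_right _ _).trans ?_
    have h1 : ∑ j ∈ S, (β * y j - π j) ≤ ∑ j ∈ S, γ * w j := Finset.sum_le_sum hw2
    rw [Finset.sum_sub_distrib, ← Finset.mul_sum, ← Finset.mul_sum] at h1
    have h2 : (∑ j ∈ S, (w j : ℝ)) ≤ K := by exact_mod_cast hK
    have h3 := mul_le_mul_of_nonneg_left h2 hγ
    have h4 := mul_le_mul_of_nonneg_left hY hβ
    linarith

section MMS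

variable {n m : ℕ} {act : Fin n → Finset (Fin m) → Prop}
  {bid : Fin n → Finset (Fin m) → Fin m → ℝ} {k : ℕ} {o : Fin m → Option (Fin n)}
  {π : Fin m → ℝ} {i : Fin n} {v : Finset (Fin m) → ℝ} {ρ : ℝ}

theorem eq_none_of_update_eq_none {o : Fin m → Option (Fin n)} {j j' : Fin m} {i : Fin n}
    (h : Function.update o j (some i) j' = none) : o j' = none := by
  rw [Function.update_apply] at h
  split_ifs at h
  exact h

/-- The state of an agent who holds the bundle `A` of value less than the goal, has paid `s`, and
sees the available items `R`. -/
structure MidAuction (v : Finset (Fin m) → ℝ) (ρ : ℝ) (A : Finset (Fin m)) (s : ℝ)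
    (R : Fin m → Prop) : Prop where
  ne : A ≠ ∅
  lt : v A < ρ
  small : ∀ j, R j → v {j} < ρ
  -- Greediness: truncated at `7`, an available marginal is at most the value of the first item, and
  -- at most half the held value once two items are held.
  one : A.card = 1 → s ≤ 7 ∧ ∀ j, R j → min (marginal v A j) 7 ≤ v A
  two : 2 ≤ A.card → ∀ j, R j → 2 * min (marginal v A j) 7 ≤ v A
  early : ¬ LateStage A.card (v A) → s ≤ v A
  -- The bounds `x` and `7 / 4 * x - 7` coincide at `x = 28 / 3`, which is why the late stage starts
  -- there.
  late : LateStage A.card (v A) → s ≤ 7 / 4 * v A - 7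

theorem MidAuction.weaken {A : Finset (Fin m)} {s : ℝ} {R R' : Fin m → Prop}
    (h : MidAuction v ρ A s R) (hR : ∀ j, R' j → R j) : MidAuction v ρ A s R' where
  ne := h.ne
  lt := h.lt
  small j hj := h.small j (hR j hj)
  one hc := ⟨(h.one hc).1, fun j hj => (h.one hc).2 j (hR j hj)⟩
  two hc j hj := h.two hc j (hR j hj)
  early := h.early
  late := h.late

/-- The final payment stays in the budget for one of three reasons. A late purchase adds at most `7
/ 2` to `7 / 4 * x - 7` with `x < ρ`. A second item costs at most `7` after a first payment of at
most `7`. Any other early purchase adds at most `x / 2` to at most `x`, where `x < 28 / 3`, so at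
most `14` is paid. -/
theorem MidAuction.buy {A : Finset (Fin m)} {s : ℝ} {R R' : Fin m → Prop} {j : Fin m}
    (hv : IsSubmodularValuation v) (hρ : 10 ≤ ρ)
    (h : MidAuction v ρ A s R) (hR : ∀ j, R' j → R j) (hj : R j) (hjA : j ∉ A)
    (hmax : ∀ j', R j' → mmsBid ρ A.card (v A) (marginal v A j') ≤
      mmsBid ρ A.card (v A) (marginal v A j)) :
    (ρ ≤ v (insert j A) ∧
        s + mmsBid ρ A.card (v A) (marginal v A j) ≤ 7 / 4 * ρ - 7 / 2) ∨
      MidAuction v ρ (insert j A) (s + mmsBid ρ A.card (v A) (marginal v A j)) R' := by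
  have hcard : (insert j A).card = A.card + 1 := Finset.card_insert_of_notMem hjA
  have hpos : A.card ≠ 0 := by simpa using h.ne
  have hadd : v (insert j A) = v A + marginal v A j := by simp [marginal]
  have hy := hv.marginal_nonneg A j
  have hlt := h.lt
  by_cases hl : LateStage A.card (v A)
  · have hs := h.late hl
    have hl' : LateStage (insert j A).card (v (insert j A)) :=
      hl.mono (by omega) (by linarith)
    rw [mmsBid_late hl] at hmax ⊢
    have hp1 := min_le_left (7 / 4 * marginal v A j) (7 / 2)
    have hp2 := min_le_right (7 / 4 * marginal v A j) (7 / 2)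
    by_cases hge : ρ ≤ v (insert j A)
    · left; exact ⟨hge, by linarith⟩
    · right
      refine ⟨Finset.insert_ne_empty _ _, not_le.1 hge, fun l hl => h.small l (hR l hl),
        fun hc => by omega, fun _ l hl0 => ?_, fun hn => absurd hl' hn, fun _ => by linarith⟩
      have h1 := h.two hl.1 l (hR l hl0)
      have h2 := min_le_min_right 7 (hv.marginal_anti (Finset.subset_insert j A) l)
      linarith
  · have hs := h.early hl
    have hbid : ∀ y, mmsBid ρ A.card (v A) y = min y 7 :=
      fun y => mmsBid_early hl fun hc => absurd hc hpos
    simp only [hbid] at hmax ⊢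
    have hp1 := min_le_left (marginal v A j) 7
    have hp2 := min_le_right (marginal v A j) 7
    by_cases hge : ρ ≤ v (insert j A)
    · left
      refine ⟨hge, ?_⟩
      by_cases hc1 : A.card = 1
      · linarith [(h.one hc1).1]
      · have hc2 : 2 ≤ A.card := by omega
        have hx : v A < 28 / 3 := by
          by_contra hx
          exact hl ⟨hc2, not_lt.1 hx⟩
        linarith [h.two hc2 j hj]
    · right
      refine ⟨Finset.insert_ne_empty _ _, not_le.1 hge, fun l hl => h.small l (hR l hl),
        fun hc => by omega, fun _ l hl0 => ?_, fun _ => by linarith, fun hl' => ?_⟩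
      · have h2 := min_le_min_right 7 (hv.marginal_anti (Finset.subset_insert j A) l)
        by_cases hc1 : A.card = 1
        · have h3 := (h.one hc1).2 l (hR l hl0)
          have h4 := hmax l (hR l hl0)
          linarith
        · have h3 := h.two (by omega) l (hR l hl0)
          linarith
      · linarith [hl'.2]

/-- A large item is bid at `14` and a small one at no more than `7`, so a small first purchase shows
that no large item is available. -/
theorem MidAuction.first {R R' : Fin m → Prop} {j : Fin m}
    (hv : IsSubmodularValuation v) (hρ : 10 ≤ ρ) (hR : ∀ j, R' j → R j)
    (hmax : ∀ j', R j' → mmsBid ρ 0 0 (v {j'}) ≤ mmsBid ρ 0 0 (v {j})) :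
    (ρ ≤ v {j} ∧ mmsBid ρ 0 0 (v {j}) ≤ 7 / 4 * ρ - 7 / 2) ∨
      MidAuction v ρ {j} (mmsBid ρ 0 0 (v {j})) R' := by
  by_cases hge : ρ ≤ v {j}
  · left
    rw [mmsBid_large hge]
    exact ⟨hge, by linarith⟩
  · right
    have hl0 : ∀ x, ¬ LateStage 0 x := fun x h => by have := h.1; omega
    have hl1 : ¬ LateStage ({j} : Finset (Fin m)).card (v {j}) := fun h => by
      have := h.1
      simp at this
    rw [mmsBid_early (hl0 _) fun _ => not_le.1 hge] at hmax ⊢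
    have hp1 := min_le_left (v {j}) 7
    have hp2 := min_le_right (v {j}) 7
    have hsmall : ∀ l, R l → v {l} < ρ := by
      intro l hl
      by_contra hc
      have := hmax l hl
      rw [mmsBid_large (not_lt.1 hc)] at this
      linarith
    refine ⟨by simp, not_le.1 hge, fun l hl => hsmall l (hR l hl), fun _ => ⟨hp2, fun l hl => ?_⟩,
      fun hc => by simp at hc, fun _ => hp1, fun h => absurd h hl1⟩
    have h1 := hmax l (hR l hl)
    rw [mmsBid_early (hl0 _) fun _ => hsmall l (hR l hl)] at h1
    have h2 := min_le_min_right 7 (hv.marginal_le_singleton {j} l)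
    linarith

theorem Auction.mms_spending (h : Auction act bid k o π) (hv : IsSubmodularValuation v)
    (hρ : 10 ≤ ρ) (hact : ∀ A, act i A ↔ v A < ρ)
    (hbid : ∀ A j, bid i A j = mmsBid ρ A.card (v A) (marginal v A j)) :
    held o i = ∅ ∨ (ρ ≤ v (held o i) ∧ ∑ j ∈ held o i, π j ≤ 7 / 4 * ρ - 7 / 2) ∨
      MidAuction v ρ (held o i) (∑ j ∈ held o i, π j) fun j => o j = none := by
  induction h with
  | start => left; simp [held]
  | idle _ _ ih => exact ih
  | @sell k o π h i' j hc hmax ih =>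
    by_cases hi : i = i'
    · subst hi
      right
      have hx := (hact _).1 hc.1
      have hmax' := fun j' hj' => hmax i j' ⟨hc.1, hj'⟩
      rw [sum_held_update_self hc.2]
      simp only [hbid] at hmax' ⊢
      rw [held_update_self]
      rcases ih with h0 | h1 | h2
      · rw [h0] at hmax' ⊢
        simp only [Finset.sum_empty, zero_add, Finset.card_empty, hv.marginal_empty, hv.empty,
          insert_empty_eq] at hmax' ⊢
        exact MidAuction.first hv hρ (fun l hl => eq_none_of_update_eq_none hl) hmax'
      · linarith [h1.1]
      · exact h2.buy hv hρ (fun l hl => eq_none_of_update_eq_none hl) hc.2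
          (by simp [mem_held, hc.2]) hmax'
    · rw [sum_held_update_of_ne hc.2 hi, held_update_of_ne hc.2 hi]
      exact ih.imp id (Or.imp id fun h1 => h1.weaken fun l hl => eq_none_of_update_eq_none hl)

theorem Auction.mms_payment_le (h : Auction act bid k o π) (hv : IsSubmodularValuation v)
    (hρ : 10 ≤ ρ) (hact : ∀ A, act i A ↔ v A < ρ)
    (hbid : ∀ A j, bid i A j = mmsBid ρ A.card (v A) (marginal v A j)) :
    ∑ j ∈ held o i, π j ≤ 7 / 4 * ρ - 7 / 2 := by
  rcases h.mms_spending hv hρ hact hbid with h1 | h1 | h1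
  · rw [h1, Finset.sum_empty]; linarith
  · exact h1.2
  · have hlt := h1.lt
    by_cases hl : LateStage (held o i).card (v (held o i))
    · linarith [h1.late hl]
    · by_cases hc : (held o i).card = 1
      · linarith [(h1.one hc).1]
      · have h2 : 2 ≤ (held o i).card := by
          have : (held o i).card ≠ 0 := by simpa using h1.ne
          omega
        have hx : v (held o i) < 28 / 3 := by
          by_contra hx
          exact hl ⟨h2, not_lt.1 hx⟩
        linarith [h1.early hl]

/-- The price of an item sold to another agent before the late stage of agent `i`. -/
structure EarlySale (v : Finset (Fin m) → ℝ) (ρ : ℝ) (A : Finset (Fin m)) (j : Fin m) (p : ℝ)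
    (later : Fin m → Prop) : Prop where
  large : 14 ≤ p ∨ v {j} < ρ
  self : min (marginal v A j) 7 ≤ p
  -- Items that were still available at that time were bid on as well, and the price beat those bids
  -- too.
  other : ∀ l, later l → min (marginal v A l) 7 ≤ p

/-- The price of an item sold to another agent during the late stage of agent `i`. -/
structure LateSale (v : Finset (Fin m) → ℝ) (ρ : ℝ) (A : Finset (Fin m)) (j : Fin m)
    (p : ℝ) : Prop where
  stage : LateStage A.card (v A)
  small : v {j} < ρ
  self : min (7 / 4 * marginal v A j) (7 / 2) ≤ p
  -- Recorded because it bounds the marginal by `ρ / 2` when the price only reaches the cap `7 / 2`.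
  two : 2 * min (marginal v A j) 7 ≤ v A

theorem EarlySale.weaken {A B : Finset (Fin m)} {j : Fin m} {p : ℝ} {later later' : Fin m → Prop}
    (h : EarlySale v ρ A j p later) (hv : IsSubmodularValuation v) (hAB : A ⊆ B)
    (hl : ∀ j, later' j → later j) : EarlySale v ρ B j p later' where
  large := h.large
  self := (min_le_min_right 7 (hv.marginal_anti hAB j)).trans h.self
  other l hl' := (min_le_min_right 7 (hv.marginal_anti hAB l)).trans (h.other l (hl l hl'))

theorem LateSale.weaken {A B : Finset (Fin m)} {j : Fin m} {p : ℝ}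
    (h : LateSale v ρ A j p) (hv : IsSubmodularValuation v) (hAB : A ⊆ B) :
    LateSale v ρ B j p where
  stage := h.stage.mono (Finset.card_le_card hAB) (hv.mono _ _ hAB)
  small := h.small
  self := le_trans (min_le_min_right _ (by linarith [hv.marginal_anti hAB j])) h.self
  two := by
    have h1 := min_le_min_right 7 (hv.marginal_anti hAB j)
    linarith [h.two, hv.mono _ _ hAB]

/-- `E` collects the items sold to others before the late stage of `i`. Bundles only grow, so this
stage never ends once reached; all other items sold to rivals are sold after those of `E`, and early
prices therefore dominate the bids on them. -/
theorem Auction.mms_price (h : Auction act bid k o π) (hv : IsSubmodularValuation v)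
    (hρ : 10 ≤ ρ) (hact : ∀ A, act i A ↔ v A < ρ)
    (hbid : ∀ A j, bid i A j = mmsBid ρ A.card (v A) (marginal v A j))
    (hi : v (held o i) < ρ) :
    ∃ E : Finset (Fin m), (∀ j ∈ E, o j ≠ none) ∧ ∀ j, o j ≠ none → o j ≠ some i →
      (j ∈ E → EarlySale v ρ (held o i) j (π j) fun l => l ∉ E ∧ o l ≠ some i) ∧
      (j ∉ E → LateSale v ρ (held o i) j (π j)) := by
  induction h with
  | start => exact ⟨∅, by simp, fun j hj => absurd rfl hj⟩
  | idle _ _ ih => exact ih hi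
  | @sell k o π h i' j' hc hmax ih =>
    have hsub := held_subset_update hc.2 i' i
    have hi0 : v (held o i) < ρ := (hv.mono _ _ hsub).trans_lt hi
    obtain ⟨E, hE, hsale⟩ := ih hi0
    have hj'E : j' ∉ E := fun hh => hE _ hh hc.2
    by_cases hii : i = i'
    · subst hii
      refine ⟨E, fun j hj hn => hE j hj (eq_none_of_update_eq_none hn), fun j hj hji => ?_⟩
      have hjj : j ≠ j' := by rintro rfl; simp at hji
      rw [Function.update_of_ne hjj] at hj hji ⊢
      refine ⟨fun hjE => ((hsale j hj hji).1 hjE).weaken hv hsub fun l hl => ⟨hl.1, fun hl2 => ?_⟩,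
        fun hjE => ((hsale j hj hji).2 hjE).weaken hv hsub⟩
      refine hl.2 ?_
      by_cases hlj : l = j'
      · rw [hlj, Function.update_self]
      · rwa [Function.update_of_ne hlj]
    · have hmax' : ∀ l, o l = none → mmsBid ρ (held o i).card (v (held o i))
          (marginal v (held o i) l) ≤ bid i' (held o i') j' := by
        intro l hl
        rw [← hbid]
        exact hmax i l ⟨(hact _).2 hi0, hl⟩
      have hsmall : held o i ≠ ∅ → MidAuction v ρ (held o i) (∑ j ∈ held o i, π j)
          fun j => o j = none := by
        intro hne
        rcases h.mms_spending hv hρ hact hbid with h1 | h1 | h1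
        · exact absurd h1 hne
        · linarith [h1.1]
        · exact h1
      rw [held_update_of_ne hc.2 hii]
      have hupd : ∀ l, l ≠ j' → Function.update o j' (some i') l = o l :=
        fun l hl => Function.update_of_ne hl _ _
      by_cases hl : LateStage (held o i).card (v (held o i))
      · refine ⟨E, fun j hj hn => hE j hj (eq_none_of_update_eq_none hn), fun j hj hji => ?_⟩
        by_cases hjj : j = j'
        · subst hjj
          refine ⟨fun hh => absurd hh hj'E, fun _ => ?_⟩
          have hmid := hsmall (by
            rintro h0
            rw [h0] at hl
            have := hl.1
            simp at this)
          rw [Function.update_self]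
          have := hmax' j hc.2
          rw [mmsBid_late hl] at this
          exact ⟨hl, hmid.small j hc.2, this, hmid.two hl.1 j hc.2⟩
        · rw [hupd j hjj] at hj hji
          rw [Function.update_of_ne hjj]
          refine ⟨fun hjE => ((hsale j hj hji).1 hjE).weaken hv subset_rfl fun l hl => ⟨hl.1, ?_⟩,
            (hsale j hj hji).2⟩
          by_cases hlj : l = j'
          · rw [hlj, hc.2]; simp
          · rw [← hupd l hlj]; exact hl.2
      · refine ⟨insert j' E, fun j hj => ?_, fun j hj hji => ?_⟩
        · by_cases hjj : j = j'
          · subst hjj; simp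
          · rw [hupd j hjj]
            exact hE j (Finset.mem_of_mem_insert_of_ne hj hjj)
        · by_cases hjj : j = j'
          · subst hjj
            refine ⟨fun _ => ?_, fun hh => absurd (Finset.mem_insert_self _ _) hh⟩
            rw [Function.update_self]
            refine ⟨?_, (le_mmsBid_early hl).trans (hmax' j hc.2), fun l hll => ?_⟩
            · by_cases h0 : held o i = ∅
              · by_cases hy : ρ ≤ v {j}
                · left
                  have := hmax' j hc.2
                  rwa [h0, hv.marginal_empty, Finset.card_empty, mmsBid_large hy] at this
                · right; exact not_le.1 hy
              · right; exact (hsmall h0).small j hc.2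
            · obtain ⟨hl1, hl2⟩ := hll
              rw [Finset.mem_insert, not_or] at hl1
              rw [hupd l hl1.1] at hl2
              by_cases hln : o l = none
              · exact (le_mmsBid_early hl).trans (hmax' l hln)
              -- An earlier sale outside `E` would be a late one, but the stage is still early.
              · exact absurd ((hsale l hln hl2).2 hl1.2).stage hl
          · rw [hupd j hjj] at hj hji
            rw [Function.update_of_ne hjj, Finset.mem_insert]
            refine ⟨fun hjE => ((hsale j hj hji).1 (hjE.resolve_left hjj)).weaken hv subset_rfl
              fun l hl => ?_, fun hjE => (hsale j hj hji).2 fun hh => hjE (Or.inr hh)⟩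
            obtain ⟨hl1, hl2⟩ := hl
            rw [Finset.mem_insert, not_or] at hl1
            exact ⟨hl1.2, by rwa [hupd l hl1.1] at hl2⟩

/-- If an agent does not reach the goal, then every bundle of value at least `27` is expensive. -/
theorem Auction.mms_bundle_price (h : Auction act bid k o π) (hv : IsSubmodularValuation v)
    (hρ : 10 ≤ ρ) (hρ' : ρ ≤ 101 / 10) (hact : ∀ A, act i A ↔ v A < ρ)
    (hbid : ∀ A j, bid i A j = mmsBid ρ A.card (v A) (marginal v A j))
    (hi : v (held o i) < ρ) (ho : ∀ j, o j ≠ none) {S : Finset (Fin m)} (hS : 27 ≤ v S) :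
    14 - 5 * (ρ - 10) ≤ ∑ j ∈ S, if o j = some i then 0 else π j := by
  obtain ⟨E, -, hsale⟩ := h.mms_price hv hρ hact hbid hi
  set A := held o i with hA
  set q : Fin m → ℝ := fun j => if o j = some i then 0 else π j with hq
  have hqA : ∀ j, o j = some i → q j = 0 ∧ marginal v A j = 0 := fun j hj =>
    ⟨if_pos hj, by simp [marginal, Finset.insert_eq_of_mem (mem_held.2 hj), hA]⟩
  have hqπ : ∀ j, o j ≠ some i → q j = π j := fun j hj => if_neg hj
  have hy0 := hv.marginal_nonneg A
  have hq0 : ∀ j, 0 ≤ q j := by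
    intro j
    by_cases hj : o j = some i
    · exact (hqA j hj).1.ge
    · rw [hqπ j hj]
      by_cases hjE : j ∈ E
      · exact le_trans (le_min (hy0 j) (by norm_num)) (((hsale j (ho j) hj).1 hjE).self)
      · exact le_trans (le_min (by linarith [hy0 j]) (by norm_num))
          (((hsale j (ho j) hj).2 hjE).self)
  -- One item of price `14` suffices; otherwise all marginals in `S` are below `ρ`.
  by_cases hlarge : ∃ j ∈ S, 14 ≤ q j
  · obtain ⟨j, hj, hj14⟩ := hlarge
    have := Finset.single_le_sum (f := q) (fun j _ => hq0 j) hj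
    change _ ≤ ∑ j ∈ S, q j
    linarith
  push Not at hlarge
  have hY : 27 - ρ ≤ ∑ j ∈ S, marginal v A j := by
    linarith [hv.le_add_sum A S]
  have hyρ : ∀ j ∈ S, marginal v A j < ρ := by
    intro j hjS
    by_cases hj : o j = some i
    · rw [(hqA j hj).2]; linarith
    · refine (hv.marginal_le_singleton A j).trans_lt ?_
      by_cases hjE : j ∈ E
      · rcases ((hsale j (ho j) hj).1 hjE).large with h1 | h1
        · have := hlarge j hjS
          rw [hqπ j hj] at this
          linarith
        · exact h1
      · exact ((hsale j (ho j) hj).2 hjE).small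
  -- If such a late item exists, all early prices are at least `7 / 2`, since the item was then
  -- available and drew a bid above `7 / 2`.
  by_cases hbig : ∃ l, o l ≠ some i ∧ l ∉ E ∧ 7 / 2 < marginal v A l
  · obtain ⟨l, hli, hlE, hly⟩ := hbig
    -- Weights count units of `7 / 2`, four of which make `14`. The shortfall per unit is at most
    -- `21 / 4` for early items of marginal at most `7`, and `7 / 8 * ρ - 7 / 2`, which is `γ`, both
    -- for early items of price at least `7` (two units) and for late items at the cap. With three
    -- units, `7 / 4 * (27 - ρ) - 3 * γ` is `14` at `ρ = 10`.
    have key := le_sum_of_weights S (π := q) (y := marginal v A) (h := 7 / 2) (β := 7 / 4)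
      (γ := 21 / 4 + 7 / 8 * (ρ - 10)) 3 (by norm_num) (by norm_num) (by linarith) hY ?_
    · refine le_trans (le_min ?_ ?_) key <;> push_cast <;> linarith
    intro j hjS
    have hyj := hyρ j hjS
    by_cases hj : o j = some i
    · obtain ⟨h1, h2⟩ := hqA j hj
      exact ⟨0, by simp [h1], by simp [h1, h2]⟩
    rw [hqπ j hj]
    by_cases hjE : j ∈ E
    · obtain ⟨-, h1, h2⟩ := (hsale j (ho j) hj).1 hjE
      have h3 := h2 l ⟨hlE, hli⟩
      have h4 : 7 / 2 ≤ π j := le_trans (le_min hly.le (by norm_num)) h3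
      rcases min_le_iff.1 h1 with h5 | h5
      · by_cases h6 : marginal v A j ≤ 7
        · exact ⟨1, by push_cast; linarith, by push_cast; linarith⟩
        · exact ⟨2, by push_cast; linarith, by push_cast; linarith⟩
      · exact ⟨2, by push_cast; linarith, by push_cast; linarith⟩
    · obtain ⟨-, -, h1, h2⟩ := (hsale j (ho j) hj).2 hjE
      rcases min_le_iff.1 h1 with h5 | h5
      · exact ⟨0, by push_cast; linarith [hq0 j, hqπ j hj], by push_cast; linarith⟩
      · refine ⟨1, by push_cast; linarith, ?_⟩
        -- Half the held value is below `ρ / 2 < 7`, so the truncation at `7` is inactive.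
        have h6 : marginal v A j ≤ ρ / 2 := by
          rcases min_le_iff.1 (show min (marginal v A j) 7 ≤ ρ / 2 by linarith) with h7 | h7
          · exact h7
          · linarith
        push_cast
        linarith
  · push Not at hbig
    -- Here late prices cover the marginals. Only early items of price at least `7` may fall short,
    -- each by at most `ρ - 7`: two of them cost `14`, and with at most one, `(27 - ρ) - (ρ - 7)` is
    -- `14` at `ρ = 10`.
    have key := le_sum_of_weights S (π := q) (y := marginal v A) (h := 7) (β := 1)
      (γ := ρ - 7) 1 (by norm_num) (by norm_num) (by linarith) hY ?_
    · refine le_trans (le_min ?_ ?_) key <;> push_cast <;> linarith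
    intro j hjS
    have hyj := hyρ j hjS
    by_cases hj : o j = some i
    · obtain ⟨h1, h2⟩ := hqA j hj
      exact ⟨0, by simp [h1], by simp [h1, h2]⟩
    have hnn := hq0 j
    rw [hqπ j hj] at hnn ⊢
    by_cases hjE : j ∈ E
    · rcases min_le_iff.1 ((hsale j (ho j) hj).1 hjE).self with h5 | h5
      · exact ⟨0, by push_cast; linarith, by push_cast; linarith⟩
      · exact ⟨1, by push_cast; linarith, by push_cast; linarith⟩
    · have h6 := hbig j hj hjE
      have := hy0 j
      rcases min_le_iff.1 ((hsale j (ho j) hj).2 hjE).self with h5 | h5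
      · exact ⟨0, by push_cast; linarith, by push_cast; linarith⟩
      · exact ⟨0, by push_cast; linarith, by push_cast; linarith⟩

theorem exists_forall_le_of_le_maximinShare {t : ℝ} (hn : 0 < n)
    (ht : t ≤ maximinShare n v) : ∃ A : Fin m → Fin n, ∀ i, t ≤ v (bundle A i) := by
  have : Nonempty (Fin n) := ⟨⟨0, hn⟩⟩
  obtain ⟨A, hA⟩ := exists_eq_ciSup_of_finite (f := fun A : Fin m → Fin n => ⨅ i, v (bundle A i))
  refine ⟨A, fun i => ht.trans ?_⟩
  rw [maximinShare, ← hA]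
  exact ciInf_le (Set.finite_range _).bddBelow i

/-- With `ε = ρ - 10`, the prices total at least `n * (14 - 5 * ε)` by the maximin partition and at
most `(n - 1) * (14 + 7 / 4 * ε)` by the budgets. The missing budget of `14` cannot be offset by the
error terms, which are below `27 / 4 * n * ε = 27 / 40`. -/
theorem Auction.mms_guarantee (h : Auction act bid m o π) (hv : IsSubmodularValuation v)
    (hn : 0 < n) (hρ : ρ = 10 + 1 / (10 * n)) (hact : ∀ A, act i A ↔ v A < ρ)
    (hbid : ∀ A j, bid i A j = mmsBid ρ A.card (v A) (marginal v A j))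
    (hβ : ∀ k, ∑ j ∈ held o k, π j ≤ 7 / 4 * ρ - 7 / 2)
    (hmms : 27 ≤ maximinShare n v) : ρ ≤ v (held o i) := by
  by_contra hlt
  rw [not_le] at hlt
  have hn1 : (1 : ℝ) ≤ n := by exact_mod_cast hn
  have he : (n : ℝ) * (ρ - 10) = 1 / 10 := by
    rw [hρ]; field_simp; ring
  have he0 : 0 < ρ - 10 := by
    by_contra hh
    nlinarith
  have he1 : ρ - 10 ≤ 1 / 10 := by nlinarith
  have ho : ∀ j, o j ≠ none := fun j hj => h.no_candidate i j ⟨(hact _).2 hlt, hj⟩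
  obtain ⟨A, hA⟩ := exists_forall_le_of_le_maximinShare hn hmms
  have h1 := sum_prices_le ho i (fun _ => 7 / 4 * ρ - 7 / 2) hβ
  rw [Finset.sum_const, Finset.card_erase_of_mem (Finset.mem_univ i), Finset.card_univ,
    Fintype.card_fin, nsmul_eq_mul, Nat.cast_sub hn] at h1
  have h2 : ∑ k : Fin n, (14 - 5 * (ρ - 10)) ≤
      ∑ k : Fin n, ∑ j ∈ bundle A k, if o j = some i then 0 else π j :=
    Finset.sum_le_sum fun k _ => h.mms_bundle_price hv (by linarith) (by linarith) hact hbid hlt ho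
      (hA k)
  unfold bundle at h2
  rw [Finset.sum_fiberwise, Finset.sum_const, Finset.card_univ, Fintype.card_fin,
    nsmul_eq_mul] at h2
  push_cast at h1
  nlinarith

end MMS

/-! ## A program logic for the random access machine -/

namespace Store

/-- Set the natural variable `x` to `k`. -/
def setNat (s : Store) (x k : ℕ) : Store := { s with natVar := Function.update s.natVar x k }

/-- Set the real variable `x` to `r`. -/
noncomputable def setReal (s : Store) (x : ℕ) (r : ℝ) : Store :=
  { s with realVar := Function.update s.realVar x r }

/-- Set the entry `y` of the array `a` of naturals to `k`. -/
def setNatArr (s : Store) (a y k : ℕ) : Store :=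
  { s with natArr := Function.update s.natArr a (Function.update (s.natArr a) y k) }

section

variable (s : Store) (a x y k : ℕ) (r : ℝ)

@[simp] theorem setNat_natVar : (s.setNat x k).natVar y = if y = x then k else s.natVar y :=
  Function.update_apply _ _ _ _
@[simp] theorem setNat_natArr : (s.setNat x k).natArr = s.natArr := rfl
@[simp] theorem setNat_realVar : (s.setNat x k).realVar = s.realVar := rfl
@[simp] theorem setNat_realArr : (s.setNat x k).realArr = s.realArr := rfl

@[simp] theorem setReal_natVar : (s.setReal x r).natVar = s.natVar := rfl
@[simp] theorem setReal_natArr : (s.setReal x r).natArr = s.natArr := rfl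
@[simp] theorem setReal_realVar : (s.setReal x r).realVar y = if y = x then r else s.realVar y :=
  Function.update_apply _ _ _ _
@[simp] theorem setReal_realArr : (s.setReal x r).realArr = s.realArr := rfl

@[simp] theorem setNatArr_natVar : (s.setNatArr a x k).natVar = s.natVar := rfl
@[simp] theorem setNatArr_natArr (a' : ℕ) : (s.setNatArr a x k).natArr a' y =
    if a' = a ∧ y = x then k else s.natArr a' y := by
  by_cases h : a' = a
  · subst h
    simp [setNatArr, Function.update_apply]
  · simp [setNatArr, h]
@[simp] theorem setNatArr_realVar : (s.setNatArr a x k).realVar = s.realVar := rfl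
@[simp] theorem setNatArr_realArr : (s.setNatArr a x k).realArr = s.realArr := rfl

end

end Store

/-- `Meets q w W P s N Q`: started with memory `s`, program `P` halts after at most `N` steps of
cost at most `1 + 3 * W` each, with a memory that satisfies `Q`. -/
def Meets (q : Oracle) (w : ℝ → ℕ) (W : ℕ) (P : Program) (s : Store) (N : ℕ)
    (Q : Store → Prop) : Prop :=
  -- An instruction reads or writes at most three real numbers.
  ∃ (k : ℕ) (s' : Store), Runs q w P s k s' ∧ k ≤ N * (1 + 3 * W) ∧ Q s'

section Meets

variable {q : Oracle} {w : ℝ → ℕ} {W N : ℕ} {P R U : Program} {s : Store} {Q Q' : Store → Prop}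

namespace Meets

theorem mono {N' : ℕ} (h : Meets q w W P s N Q) (hN : N ≤ N') (hQ : ∀ s', Q s' → Q' s') :
    Meets q w W P s N' Q' := by
  obtain ⟨k, s', h1, h2, h3⟩ := h
  exact ⟨k, s', h1, h2.trans (Nat.mul_le_mul_right _ hN), hQ _ h3⟩

theorem skip (hQ : Q s) : Meets q w W .skip s (N + 1) Q :=
  ⟨1, s, .skip s, by nlinarith [Nat.zero_le (N * (1 + 3 * W))], hQ⟩

theorem seq {N₁ N₂ : ℕ} (h : Meets q w W P s N₁ fun s' => Meets q w W R s' N₂ Q)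
    (hN : N₁ + N₂ ≤ N) : Meets q w W (.seq P R) s N Q := by
  obtain ⟨k, s', h1, h2, l, s'', h3, h4, h5⟩ := h
  refine ⟨k + l, s'', .seq h1 h3, ?_, h5⟩
  have := Nat.mul_le_mul_right (1 + 3 * W) hN
  linarith

theorem seq_assoc (h : Meets q w W (.seq P (.seq R U)) s N Q) :
    Meets q w W (.seq (.seq P R) U) s N Q := by
  obtain ⟨k, s', h1, h2, h3⟩ := h
  cases h1 with
  | seq hP hRU =>
    cases hRU with
    | seq hR hU =>
      exact ⟨_, s', .seq (.seq hP hR) hU, by rwa [add_assoc], h3⟩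

theorem cond {x : ℕ} (h1 : s.natVar x ≠ 0 → Meets q w W P s N Q)
    (h2 : s.natVar x = 0 → Meets q w W R s N Q) : Meets q w W (.cond x P R) s (N + 1) Q := by
  by_cases hx : s.natVar x = 0
  · obtain ⟨k, s', h3, h4, h5⟩ := h2 hx
    exact ⟨1 + k, s', .condFalse hx h3, by linarith, h5⟩
  · obtain ⟨k, s', h3, h4, h5⟩ := h1 hx
    exact ⟨1 + k, s', .condTrue hx h3, by linarith, h5⟩

/-- Pushes the continuation into both branches, so that the outcome of the test remains known while
it runs. -/
theorem seq_cond {x : ℕ} (h1 : s.natVar x ≠ 0 → Meets q w W (.seq P U) s N Q)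
    (h2 : s.natVar x = 0 → Meets q w W (.seq R U) s N Q) :
    Meets q w W (.seq (.cond x P R) U) s (N + 1) Q := by
  by_cases hx : s.natVar x = 0
  · obtain ⟨k, s', h3, h4, h5⟩ := h2 hx
    cases h3 with
    | seq hP hU => exact ⟨_, s', .seq (.condFalse hx hP) hU, by linarith, h5⟩
  · obtain ⟨k, s', h3, h4, h5⟩ := h1 hx
    cases h3 with
    | seq hP hU => exact ⟨_, s', .seq (.condTrue hx hP) hU, by linarith, h5⟩

theorem seq_skip (h : Meets q w W U s N Q) : Meets q w W (.seq .skip U) s (N + 1) Q := by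
  obtain ⟨k, s', h3, h4, h5⟩ := h
  exact ⟨1 + k, s', .seq (.skip s) h3, by linarith, h5⟩

theorem instr {c : Instr} (hc : c.cost q w s ≤ 1 + 3 * W) (hQ : Q (c.apply q s)) :
    Meets q w W (.instr c) s (N + 1) Q :=
  ⟨_, _, .instr c s, by nlinarith [Nat.zero_le (N * (1 + 3 * W))], hQ⟩

theorem seq_instr {c : Instr} (hc : c.cost q w s ≤ 1 + 3 * W)
    (h : Meets q w W U (c.apply q s) N Q) : Meets q w W (.seq (.instr c) U) s (N + 1) Q :=
  seq (N₁ := 0 + 1) (instr hc h) (by omega)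

variable {x y z k a : ℕ}

theorem natConst (h : Meets q w W U (s.setNat x k) N Q) :
    Meets q w W (.seq (.instr (.natConst x k)) U) s (N + 1) Q :=
  seq_instr (by simp [Instr.cost]) h

theorem natAdd (h : Meets q w W U (s.setNat x (s.natVar y + s.natVar z)) N Q) :
    Meets q w W (.seq (.instr (.natAdd x y z)) U) s (N + 1) Q :=
  seq_instr (by simp [Instr.cost]) h

theorem natSub (h : Meets q w W U (s.setNat x (s.natVar y - s.natVar z)) N Q) :
    Meets q w W (.seq (.instr (.natSub x y z)) U) s (N + 1) Q :=
  seq_instr (by simp [Instr.cost]) h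

theorem natLoad (h : Meets q w W U (s.setNat x (s.natArr a (s.natVar y))) N Q) :
    Meets q w W (.seq (.instr (.natLoad x a y)) U) s (N + 1) Q :=
  seq_instr (by simp [Instr.cost]) h

theorem natStore (h : Meets q w W U (s.setNatArr a (s.natVar y) (s.natVar x)) N Q) :
    Meets q w W (.seq (.instr (.natStore a y x)) U) s (N + 1) Q :=
  seq_instr (by simp [Instr.cost]) h

theorem realConst (hw : w (k : ℝ) ≤ W) (h : Meets q w W U (s.setReal x k) N Q) :
    Meets q w W (.seq (.instr (.realConst x k)) U) s (N + 1) Q :=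
  seq_instr (by simp only [Instr.cost]; omega) h

theorem realArith {op : ArithOp} (h1 : w (s.realVar y) ≤ W) (h2 : w (s.realVar z) ≤ W)
    (h3 : w (op.value (s.realVar y) (s.realVar z)) ≤ W)
    (h : Meets q w W U (s.setReal x (op.value (s.realVar y) (s.realVar z))) N Q) :
    Meets q w W (.seq (.instr (.realArith op x y z)) U) s (N + 1) Q :=
  seq_instr (by simp only [Instr.cost]; omega) h

theorem realLoad (hw : w (s.realArr a (s.natVar y)) ≤ W)
    (h : Meets q w W U (s.setReal x (s.realArr a (s.natVar y))) N Q) :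
    Meets q w W (.seq (.instr (.realLoad x a y)) U) s (N + 1) Q :=
  seq_instr (by simp only [Instr.cost]; omega) h

theorem realCompare (h1 : w (s.realVar y) ≤ W) (h2 : w (s.realVar z) ≤ W)
    (h : Meets q w W U (s.setNat x (if s.realVar y ≤ s.realVar z then 1 else 0)) N Q) :
    Meets q w W (.seq (.instr (.realCompare x y z)) U) s (N + 1) Q :=
  seq_instr (by simp only [Instr.cost]; omega) h

theorem query (hw : w (q (s.natVar y) (s.natArr a)) ≤ W)
    (h : Meets q w W U (s.setReal x (q (s.natVar y) (s.natArr a))) N Q) :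
    Meets q w W (.seq (.instr (.query x y a)) U) s (N + 1) Q :=
  seq_instr (by simp only [Instr.cost]; omega) h

end Meets

/-- Run `body` for the values `0, 1, …` of the natural variable `c` that are less than the natural
variable `lim`; the natural variable `d` is used for the loop test, and `one` holds `1`. -/
def forLoop (c d lim one : ℕ) (body : Program) : Program :=
  .seq (.instr (.natConst c 0)) (.seq (.instr (.natSub d lim c))
    (.loop d (.seq body (.seq (.instr (.natAdd c c one))
      (.seq (.instr (.natSub d lim c)) .skip)))))

/-- The invariant has to be insensitive to the counter `c` and the test variable `d`. One pass costs
the body, two updates, the closing `skip` and the loop test, which explains `N + 4`. -/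
theorem Meets.forLoop {c d lim one M : ℕ} {body : Program} (I : ℕ → Store → Prop)
    (hd : d ≠ c) (hlimc : lim ≠ c)
    (hstable : ∀ k s x, I k s → I k (s.setNat c x) ∧ I k (s.setNat d x))
    (hlim : ∀ k s, I k s → s.natVar lim = M ∧ s.natVar one = 1)
    (hbody : ∀ k s, k < M → s.natVar c = k → I k s →
      Meets q w W body s N fun s' => s'.natVar c = k ∧ I (k + 1) s')
    (h0 : I 0 s) :
    Meets q w W (forLoop c d lim one body) s (M * (N + 4) + 3) (I M) := by
  have loop : ∀ r k s, k + r = M → s.natVar c = k → s.natVar d = r → I k s →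
      Meets q w W (.loop d (.seq body (.seq (.instr (.natAdd c c one))
        (.seq (.instr (.natSub d lim c)) .skip)))) s (r * (N + 4) + 1) (I M) := by
    intro r
    induction r with
    | zero =>
      intro k s hk _ hd0 hI
      rw [add_zero] at hk
      exact ⟨1, s, .loopStop hd0, by nlinarith [Nat.zero_le W], hk ▸ hI⟩
    | succ r ih =>
      intro k s hk hc hd0 hI
      have hb : Meets q w W (.seq body (.seq (.instr (.natAdd c c one))
          (.seq (.instr (.natSub d lim c)) .skip))) s (N + 3)
          fun s' => s'.natVar c = k + 1 ∧ s'.natVar d = r ∧ I (k + 1) s' := by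
        refine Meets.seq (N₂ := 3) (Meets.mono (hbody k s (by omega) hc hI) le_rfl ?_) le_rfl
        rintro s' ⟨hc', hI'⟩
        obtain ⟨hl, ho⟩ := hlim _ _ hI'
        refine Meets.natAdd (Meets.natSub (Meets.skip ?_))
        refine ⟨by simp [Ne.symm hd, hc', ho], by simp [hlimc, hl, hc', ho]; omega, ?_⟩
        exact (hstable _ _ _ (hstable _ _ _ hI').1).2
      obtain ⟨k₁, s₁, hr, hk₁, hc₁, hd₁, hI₁⟩ := hb
      obtain ⟨k₂, s₂, hr₂, hk₂, hI₂⟩ := ih (k + 1) s₁ (by omega) hc₁ hd₁ hI₁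
      exact ⟨_, s₂, .loopStep (by omega) hr hr₂, by nlinarith [Nat.zero_le W], hI₂⟩
  obtain ⟨hl, -⟩ := hlim _ _ h0
  refine Meets.natConst (Meets.natSub (loop M 0 _ (by omega) (by simp [Ne.symm hd])
    (by simp [hlimc, hl]) ?_))
  exact (hstable _ _ _ (hstable _ _ _ h0).1).2

end Meets

/-- The memories agree in all arrays of reals, and in the natural variables, the real variables and
the arrays of naturals whose names are below the given bounds. -/
structure Agree (a b c : ℕ) (s s' : Store) : Prop where
  natVar : ∀ x < a, s'.natVar x = s.natVar x
  realVar : ∀ x < b, s'.realVar x = s.realVar x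
  natArr : ∀ x < c, s'.natArr x = s.natArr x
  realArr : s'.realArr = s.realArr

namespace Agree

variable {a b c a' b' c' : ℕ} {s s' s'' : Store}

theorem refl (s : Store) : Agree a b c s s := ⟨fun _ _ => rfl, fun _ _ => rfl, fun _ _ => rfl, rfl⟩

theorem trans (h : Agree a b c s s') (h' : Agree a b c s' s'') : Agree a b c s s'' where
  natVar x hx := (h'.natVar x hx).trans (h.natVar x hx)
  realVar x hx := (h'.realVar x hx).trans (h.realVar x hx)
  natArr x hx := (h'.natArr x hx).trans (h.natArr x hx)
  realArr := h'.realArr.trans h.realArr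

theorem mono (h : Agree a b c s s') (ha : a' ≤ a) (hb : b' ≤ b) (hc : c' ≤ c) :
    Agree a' b' c' s s' where
  natVar x hx := h.natVar x (hx.trans_le ha)
  realVar x hx := h.realVar x (hx.trans_le hb)
  natArr x hx := h.natArr x (hx.trans_le hc)
  realArr := h.realArr

theorem setNat (h : Agree a b c s s') {x k : ℕ} (hx : a ≤ x) : Agree a b c s (s'.setNat x k) where
  natVar y hy := by
    have : y ≠ x := by omega
    simp [this, h.natVar y hy]
  realVar := h.realVar
  natArr := h.natArr
  realArr := h.realArr

theorem setReal (h : Agree a b c s s') {x : ℕ} {r : ℝ} (hx : b ≤ x) :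
    Agree a b c s (s'.setReal x r) where
  natVar := h.natVar
  realVar y hy := by
    have : y ≠ x := by omega
    simp [this, h.realVar y hy]
  natArr := h.natArr
  realArr := h.realArr

theorem setNatArr (h : Agree a b c s s') {x y k : ℕ} (hx : c ≤ x) :
    Agree a b c s (s'.setNatArr x y k) where
  natVar := h.natVar
  realVar := h.realVar
  natArr z hz := by
    have : z ≠ x := by omega
    rw [← h.natArr z hz]
    ext l
    simp [this]
  realArr := h.realArr

end Agree

/-- A scale of sets of real numbers that bounds the sizes of the results of nested arithmetic
operations. -/
structure Scale (w : ℝ → ℕ) (W : ℕ) (G : ℕ → Set ℝ) : Prop where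
  mono : ∀ d, G d ⊆ G (d + 1)
  -- The largest constant in the bidding rules is `270`; the depth bound `12` below leaves slack.
  nat : ∀ k : ℕ, k ≤ 270 → (k : ℝ) ∈ G 0
  arith : ∀ (op : ArithOp) d x y, x ∈ G d → y ∈ G d → op.value x y ∈ G (d + 1)
  size_le : ∀ d x, d ≤ 12 → x ∈ G d → w x ≤ W

namespace Scale

variable {w : ℝ → ℕ} {W : ℕ} {G : ℕ → Set ℝ}

theorem mono_le (h : Scale w W G) {d e : ℕ} (hde : d ≤ e) : G d ⊆ G e := by
  induction e, hde using Nat.le_induction with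
  | base => exact subset_rfl
  | succ e _ ih => exact ih.trans (h.mono e)

theorem op_mem (h : Scale w W G) (op : ArithOp) {d d' e : ℕ} {x y : ℝ} (hx : x ∈ G d)
    (hy : y ∈ G d') (hd : d < e) (hd' : d' < e) : op.value x y ∈ G e := by
  obtain ⟨e, rfl⟩ : ∃ f, e = f + 1 := ⟨e - 1, by omega⟩
  exact h.arith op e x y (h.mono_le (by omega) hx) (h.mono_le (by omega) hy)

end Scale

/-! ## The auction program -/

/-- A sequence of elementary instructions, followed by a program. -/
def instrs : List Instr → Program → Program
  | [], P => P
  | c :: l, P => .seq (.instr c) (instrs l P)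

/-- A bidding rule: `goal b t` is the value at which an agent with entitlement `b` and input `t`
stops, and `price b t c x y` is the bid for an item of marginal value `y` of an agent who holds
`c` items of total value `x`. -/
structure BiddingRule where
  goal : ℝ → ℝ → ℝ
  price : ℝ → ℝ → ℕ → ℝ → ℝ → ℝ
  goalCode : Program
  priceCode : Program

/-- The code computes the goal and the bids of the agent in the natural variable 5.  The number of
items held is in the natural variable 12, their value in the real variable 1, and the marginal
value in the real variable 2. -/
structure BiddingRule.Correct (R : BiddingRule) : Prop where
  goal_spec : ∀ (q : Oracle) (w : ℝ → ℕ) (W : ℕ) (G : ℕ → Set ℝ), Scale w W G → ∀ s : Store,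
    s.realArr 0 (s.natVar 5) ∈ G 0 → s.realArr 1 (s.natVar 5) ∈ G 0 →
    Meets q w W R.goalCode s 100 fun s' => Agree 13 3 3 s s' ∧
      s'.realVar 4 = R.goal (s.realArr 0 (s.natVar 5)) (s.realArr 1 (s.natVar 5)) ∧
      w (s'.realVar 4) ≤ W
  price_spec : ∀ (q : Oracle) (w : ℝ → ℕ) (W : ℕ) (G : ℕ → Set ℝ), Scale w W G → ∀ s : Store,
    s.realArr 0 (s.natVar 5) ∈ G 0 → s.realArr 1 (s.natVar 5) ∈ G 0 → s.realVar 1 ∈ G 0 →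
    -- A marginal is a difference of two queried values, hence one level above the input.
    s.realVar 2 ∈ G 1 → s.natVar 2 = 1 →
    Meets q w W R.priceCode s 100 fun s' => Agree 13 3 3 s s' ∧
      s'.realVar 3 = R.price (s.realArr 0 (s.natVar 5)) (s.realArr 1 (s.natVar 5))
        (s.natVar 12) (s.realVar 1) (s.realVar 2) ∧ w (s'.realVar 3) ≤ W

/-- Mark the items of the agent in variable 5 in array 2, and count them in variable 12. -/
def markCode : Program :=
  .seq (.instr (.natConst 12 0)) (forLoop 10 11 1 2
    -- Array 1 holds the owner plus one, and zero for unsold items. The two truncated differences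
    -- add up to an absolute difference, which is zero exactly for the agent's own items.
    (instrs [.natLoad 13 1 10, .natAdd 14 5 2, .natSub 15 13 14, .natSub 16 14 13,
      .natAdd 15 15 16, .natConst 17 0]
      (.seq (.cond 15 .skip (instrs [.natConst 17 1, .natAdd 12 12 2] .skip))
        (instrs [.natStore 2 10 17] .skip))))

/-- Remember the current agent and item, and the bid, as the best ones. -/
def takeCode : Program :=
  -- Adding zero serves as a copy instruction.
  instrs [.realConst 5 0, .realArith .add 0 3 5, .natConst 7 1, .natConst 13 0, .natAdd 8 5 13,
    .natAdd 9 10 13] .skip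

/-- Compute the bid of the current agent for the item in variable 10, if it is available. -/
def probeCode (R : BiddingRule) : Program :=
  instrs [.natLoad 13 1 10] (.cond 13 .skip
    -- The item is marked only for the query. Variable 7 tells whether a best bid has been recorded
    -- yet.
    (instrs [.natStore 2 10 2, .query 2 5 2, .natConst 13 0, .natStore 2 10 13,
      .realArith .sub 2 2 1] (.seq R.priceCode
        (.cond 7 (instrs [.realCompare 13 3 0] (.cond 13 .skip takeCode)) takeCode))))

/-- Compute all bids of the agent in variable 5. -/
def agentCode (R : BiddingRule) : Program :=
  .seq markCode (instrs [.query 1 5 2] (.seq R.goalCode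
    (instrs [.realCompare 13 4 1] (.cond 13 .skip (forLoop 10 11 1 2 (probeCode R))))))

/-- One round of the auction. -/
def roundCode (R : BiddingRule) : Program :=
  instrs [.natConst 7 0] (.seq (forLoop 5 6 0 2 (agentCode R))
    (.cond 7 (instrs [.natAdd 13 8 2, .natStore 1 9 13, .natStore 0 9 8] .skip) .skip))

/-- The whole auction. -/
def BiddingRule.program (R : BiddingRule) : Program :=
  instrs [.natConst 2 1] (forLoop 3 4 1 2 (roundCode R))

/-- The participation rule of the auction. -/
def BiddingRule.Active (R : BiddingRule) (I : AllocationInstance) (t : Fin I.n → ℝ) (i : Fin I.n)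
    (A : Finset (Fin I.m)) : Prop :=
  I.v i A < R.goal (I.b i) (t i)

/-- The bids of the auction. -/
noncomputable def BiddingRule.bid (R : BiddingRule) (I : AllocationInstance) (t : Fin I.n → ℝ)
    (i : Fin I.n) (A : Finset (Fin I.m)) (j : Fin I.m) : ℝ :=
  R.price (I.b i) (t i) A.card (I.v i A) (marginal (I.v i) A j)

/-- The memory holds the input, and the constant `1`. -/
structure HoldsInput (I : AllocationInstance) (t : Fin I.n → ℝ) (s : Store) : Prop where
  agents : s.natVar 0 = I.n
  items : s.natVar 1 = I.m
  one : s.natVar 2 = 1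
  entitlement : ∀ i : Fin I.n, s.realArr 0 i = I.b i
  threshold : ∀ i : Fin I.n, s.realArr 1 i = t i

/-- The memory describes the owners of the items. -/
def HoldsOwners {n m : ℕ} (o : Fin m → Option (Fin n)) (s : Store) : Prop :=
  ∀ j : Fin m, s.natArr 1 j = (o j).elim 0 (fun i => (i : ℕ) + 1) ∧
    s.natArr 0 j = (o j).elim 0 (fun i => (i : ℕ))

/-- The memory describes a best pair of the set `D`. -/
def HoldsBest {n m : ℕ} (w : ℝ → ℕ) (W : ℕ) (val : Fin n → Fin m → ℝ) (D : Fin n → Fin m → Prop)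
    (s : Store) : Prop :=
  (s.natVar 7 = 0 ∧ ∀ i j, ¬ D i j) ∨
    (s.natVar 7 = 1 ∧ ∃ i j, D i j ∧ s.natVar 8 = i ∧ s.natVar 9 = j ∧ s.realVar 0 = val i j ∧
      w (val i j) ≤ W ∧ ∀ i' j', D i' j' → val i' j' ≤ val i j)

/-- The memory describes the bundle of agent `i` in array 2. -/
def HoldsBundle {n m : ℕ} (o : Fin m → Option (Fin n)) (i : Fin n) (s : Store) : Prop :=
  ∀ j : Fin m, s.natArr 2 j = if o j = some i then 1 else 0

theorem HoldsInput.agree {I : AllocationInstance} {t : Fin I.n → ℝ} {s s' : Store} {a b c : ℕ}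
    (h : HoldsInput I t s) (hs : Agree a b c s s') (ha : 3 ≤ a) : HoldsInput I t s' where
  agents := (hs.natVar 0 (by omega)).trans h.agents
  items := (hs.natVar 1 (by omega)).trans h.items
  one := (hs.natVar 2 (by omega)).trans h.one
  entitlement i := by rw [hs.realArr]; exact h.entitlement i
  threshold i := by rw [hs.realArr]; exact h.threshold i

/-! ### Preservation and update of the memory descriptions. -/

section

variable {n m : ℕ} {o : Fin m → Option (Fin n)} {s s' : Store} {a b c : ℕ}
  {w : ℝ → ℕ} {W : ℕ} {val : Fin n → Fin m → ℝ} {D D' : Fin n → Fin m → Prop} {i : Fin n}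

theorem HoldsOwners.agree (h : HoldsOwners o s) (hs : Agree a b c s s') (hc : 2 ≤ c) :
    HoldsOwners o s' := by
  intro j
  rw [hs.natArr 0 (by omega), hs.natArr 1 (by omega)]
  exact h j

theorem HoldsBest.agree (h : HoldsBest w W val D s) (hs : Agree a b c s s') (ha : 10 ≤ a)
    (hb : 1 ≤ b) : HoldsBest w W val D s' := by
  unfold HoldsBest
  rw [hs.natVar 7 (by omega), hs.natVar 8 (by omega), hs.natVar 9 (by omega),
    hs.realVar 0 (by omega)]
  exact h

theorem HoldsBest.congr (h : HoldsBest w W val D s) (hD : ∀ i j, D i j ↔ D' i j) :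
    HoldsBest w W val D' s := by
  have : D = D' := by ext i j; exact hD i j
  exact this ▸ h

theorem HoldsBest.insert_le (h : HoldsBest w W val D s) {i : Fin n} {j : Fin m}
    (h7 : s.natVar 7 ≠ 0) (hle : val i j ≤ s.realVar 0) :
    HoldsBest w W val (fun i' j' => D i' j' ∨ (i' = i ∧ j' = j)) s := by
  rcases h with h | ⟨h, i₀, j₀, h1, h2, h3, h4, h5, h6⟩
  · exact absurd h.1 h7
  · refine Or.inr ⟨h, i₀, j₀, Or.inl h1, h2, h3, h4, h5, ?_⟩
    rintro i' j' (hd | ⟨rfl, rfl⟩)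
    · exact h6 i' j' hd
    · rwa [← h4]

theorem HoldsBest.insert_new (h : HoldsBest w W val D s) {i : Fin n} {j : Fin m}
    (hle : s.natVar 7 ≠ 0 → s.realVar 0 ≤ val i j) (h7 : s'.natVar 7 = 1) (h8 : s'.natVar 8 = i)
    (h9 : s'.natVar 9 = j) (h0 : s'.realVar 0 = val i j) (hw : w (val i j) ≤ W) :
    HoldsBest w W val (fun i' j' => D i' j' ∨ (i' = i ∧ j' = j)) s' := by
  refine Or.inr ⟨h7, i, j, Or.inr ⟨rfl, rfl⟩, h8, h9, h0, hw, ?_⟩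
  rintro i' j' (hd | ⟨rfl, rfl⟩)
  · rcases h with h | ⟨h, i₀, j₀, h1, h2, h3, h4, h5, h6⟩
    · exact absurd hd (h.2 i' j')
    · exact (h6 i' j' hd).trans (h4 ▸ hle (by omega))
  · exact le_rfl

end

/-! ### Correctness of the code that marks a bundle. -/

section Program

variable {w : ℝ → ℕ} {W : ℕ} {I : AllocationInstance} {t : Fin I.n → ℝ}
  {o : Fin I.m → Option (Fin I.n)} {s : Store} {i : Fin I.n} {q : Oracle}

theorem held_filter_succ {n m : ℕ} (o : Fin m → Option (Fin n)) (i : Fin n) (j : Fin m) :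
    ((held o i).filter fun l : Fin m => (l : ℕ) < j + 1).card =
      ((held o i).filter fun l : Fin m => (l : ℕ) < j).card + if o j = some i then 1 else 0 := by
  by_cases h : o j = some i
  · rw [if_pos h, ← Finset.card_insert_of_notMem (a := j) (by simp)]
    congr 1
    ext l
    simp only [Finset.mem_filter, Finset.mem_insert, mem_held]
    constructor
    · rintro ⟨h1, h2⟩
      rcases Nat.lt_succ_iff_lt_or_eq.1 h2 with h3 | h3
      · exact Or.inr ⟨h1, h3⟩
      · exact Or.inl (Fin.ext h3)
    · rintro (rfl | ⟨h1, h2⟩)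
      · exact ⟨h, by omega⟩
      · exact ⟨h1, by omega⟩
  · rw [if_neg h, add_zero]
    congr 1
    ext l
    simp only [Finset.mem_filter, mem_held]
    refine and_congr_right fun h1 => ?_
    have : l ≠ j := by rintro rfl; exact h h1
    have : (l : ℕ) ≠ j := fun hh => this (Fin.ext hh)
    omega

theorem markCode_spec (hI : HoldsInput I t s) (ho : HoldsOwners o s) (hi : s.natVar 5 = i) :
    Meets q w W markCode s (24 * I.m + 4) fun s' => Agree 10 1 2 s s' ∧
      s'.natVar 12 = (held o i).card ∧ HoldsBundle o i s' := by
  have key := Meets.forLoop (q := q) (w := w) (W := W) (N := 20) (c := 10) (d := 11) (lim := 1)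
    (one := 2) (M := I.m) (s := s.setNat 12 0)
    (body := instrs [.natLoad 13 1 10, .natAdd 14 5 2, .natSub 15 13 14, .natSub 16 14 13,
      .natAdd 15 15 16, .natConst 17 0]
      (.seq (.cond 15 .skip (instrs [.natConst 17 1, .natAdd 12 12 2] .skip))
        (instrs [.natStore 2 10 17] .skip)))
    (fun k s' => Agree 10 1 2 s s' ∧
      s'.natVar 12 = ((held o i).filter fun l : Fin I.m => (l : ℕ) < k).card ∧
      ∀ j : Fin I.m, (j : ℕ) < k → s'.natArr 2 j = if o j = some i then 1 else 0)
    (by decide) (by decide) ?_ ?_ ?_ ?_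
  · refine Meets.natConst (Meets.mono key (by omega) ?_)
    rintro s' ⟨h1, h2, h3⟩
    refine ⟨h1, ?_, fun j => h3 j j.2⟩
    rw [h2]
    congr 1
    exact Finset.filter_true_of_mem fun l _ => l.2
  · rintro k s' x ⟨h1, h2, h3⟩
    exact ⟨⟨h1.setNat (by omega), by simpa using h2, by simpa using h3⟩,
      ⟨h1.setNat (by omega), by simpa using h2, by simpa using h3⟩⟩
  · rintro k s' ⟨h1, -, -⟩
    have := hI.agree h1 (by omega)
    exact ⟨this.items, this.one⟩
  · rintro k s' hk hc ⟨h1, h2, h3⟩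
    have hI' := hI.agree h1 (by omega)
    have ho' := (ho.agree h1 (by omega) ⟨k, hk⟩).1
    have hi' : s'.natVar 5 = i := (h1.natVar 5 (by omega)).trans hi
    have hone := hI'.one
    have hcard := held_filter_succ o i ⟨k, hk⟩
    simp only at ho' hcard
    simp only [instrs]
    refine Meets.natLoad (Meets.natAdd (Meets.natSub (Meets.natSub (Meets.natAdd (Meets.natConst
      (Meets.seq_cond ?_ ?_))))))
    · intro hne
      simp only [Store.setNat_natVar, hc, hi', hone, ho'] at hne
      refine Meets.seq_skip (Meets.natStore (Meets.skip ⟨by simpa using hc, ?_, ?_, ?_⟩))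
      · refine Agree.setNatArr ?_ (by omega)
        iterate 6 refine Agree.setNat ?_ (by omega)
        exact h1
      · have hoi : o ⟨k, hk⟩ ≠ some i := by
          rintro hh
          simp [hh] at hne
        rw [hcard, if_neg hoi]
        simpa using h2
      · have hoi : o ⟨k, hk⟩ ≠ some i := by
          rintro hh
          simp [hh] at hne
        intro j hj
        by_cases hjk : j = ⟨k, hk⟩
        · subst hjk
          rw [if_neg hoi]
          simp [hc]
        · have hjk' : (j : ℕ) ≠ k := fun hh => hjk (Fin.ext hh)
          simpa [hc, hjk'] using h3 j (by omega)
    · intro heq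
      simp only [Store.setNat_natVar, hc, hi', hone, ho'] at heq
      have hoi : o ⟨k, hk⟩ = some i := by
        cases hok : o ⟨k, hk⟩ with
        | none => simp [hok] at heq
        | some l =>
          simp [hok] at heq
          congr 1
          exact Fin.ext (by omega)
      refine Meets.seq_assoc (Meets.natConst (Meets.seq_assoc (Meets.natAdd (Meets.seq_skip
        (Meets.natStore (Meets.skip ⟨by simpa using hc, ?_, ?_, ?_⟩))))))
      · refine Agree.setNatArr ?_ (by omega)
        iterate 8 refine Agree.setNat ?_ (by omega)
        exact h1
      · rw [hcard, if_pos hoi]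
        simp [h2, hone]
      · intro j hj
        by_cases hjk : j = ⟨k, hk⟩
        · subst hjk
          rw [if_pos hoi]
          simp [hc]
        · have hjk' : (j : ℕ) ≠ k := fun hh => hjk (Fin.ext hh)
          simpa [hc, hjk'] using h3 j (by omega)
  · refine ⟨(Agree.refl s).setNat (by omega), by simp, by simp⟩

end Program

/-! ### Correctness of the auction loops, from a single bid to the whole program. -/

section Program

variable {w : ℝ → ℕ} {W : ℕ} {G : ℕ → Set ℝ} {I : AllocationInstance} {t : Fin I.n → ℝ}
  {o : Fin I.m → Option (Fin I.n)} {s : Store} {i : Fin I.n} {R : BiddingRule}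

theorem oracle_eq (i : Fin I.n) {f : ℕ → ℕ} {A : Finset (Fin I.m)}
    (h : ∀ j : Fin I.m, f j ≠ 0 ↔ j ∈ A) : I.oracle i f = I.v i A := by
  have : (Finset.univ.filter fun j : Fin I.m => f j ≠ 0) = A := by
    ext j
    simp [← h j]
  simp [AllocationInstance.oracle, this]

theorem takeCode_spec {q : Oracle} {N : ℕ} {Q : Store → Prop} (hG : Scale w W G)
    (hw : w (s.realVar 3) ≤ W)
    (h : Q ((((((s.setReal 5 ((0 : ℕ) : ℝ)).setReal 0 (s.realVar 3)).setNat 7 1).setNat 13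
      0).setNat 8 (s.natVar 5)).setNat 9 (s.natVar 10))) :
    Meets q w W takeCode s (N + 7) Q := by
  have h0 : w ((0 : ℕ) : ℝ) ≤ W := hG.size_le 0 _ (by omega) (hG.nat 0 (by omega))
  simp only [takeCode, instrs]
  refine Meets.realConst h0 (Meets.realArith ?_ ?_ ?_ (Meets.natConst (Meets.natConst
    (Meets.natAdd (Meets.natAdd (Meets.skip ?_))))))
  · simpa using hw
  · simpa using h0
  · simpa [ArithOp.value] using hw
  · simpa [ArithOp.value] using h

/-- `D` is the set of pairs compared so far. The only real number carried from one agent to the next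
is the best bid, and `HoldsBest` carries a bound on its size, so sizes do not accumulate. -/
theorem probeCode_spec (hR : R.Correct) (hG : Scale w W G) (hb : ∀ i, I.b i ∈ G 0)
    (ht : ∀ i, t i ∈ G 0) (hv : ∀ i S, I.v i S ∈ G 0) (hI : HoldsInput I t s)
    (ho : HoldsOwners o s) (hi : s.natVar 5 = i) (j : Fin I.m) (hj : s.natVar 10 = j)
    (hcard : s.natVar 12 = (held o i).card) (hx : s.realVar 1 = I.v i (held o i))
    (hB : HoldsBundle o i s) {D : Fin I.n → Fin I.m → Prop}
    (hD : HoldsBest w W (fun i j => R.bid I t i (held o i) j) D s) :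
    Meets I.oracle w W (probeCode R) s 130 fun s' => s'.natVar 10 = j ∧ Agree 7 0 2 s s' ∧
      s'.natVar 12 = (held o i).card ∧ s'.realVar 1 = I.v i (held o i) ∧ HoldsBundle o i s' ∧
      HoldsBest w W (fun i j => R.bid I t i (held o i) j)
        (fun i' j' => D i' j' ∨ (o j = none ∧ i' = i ∧ j' = j)) s' := by
  have hoj := (ho j).1
  have hone := hI.one
  simp only [probeCode, instrs]
  refine Meets.natLoad (Meets.cond ?_ ?_)
  · intro hne
    have hne' : o j ≠ none := by
      intro hn
      simp [hj, hoj, hn] at hne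
    refine Meets.skip ⟨by simpa using hj, (Agree.refl s).setNat (by omega), by simpa using hcard,
      by simpa using hx, by simpa [HoldsBundle] using hB, ?_⟩
    refine (hD.agree ((Agree.refl s).setNat (a := 13) (b := 1) (c := 0) (by omega)) (by omega)
      (by omega)).congr fun i' j' => ?_
    tauto
  · intro heq
    have hnone : o j = none := by
      cases hok : o j with
      | none => rfl
      | some l => simp [hj, hoj, hok] at heq
    have hq : I.oracle i (((s.setNat 13 (s.natArr 1 j)).setNatArr 2 j 1).natArr 2) =
        I.v i (insert j (held o i)) := by
      refine oracle_eq i fun l => ?_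
      rw [Finset.mem_insert, mem_held, Store.setNatArr_natArr, Store.setNat_natArr, hB l]
      by_cases hlj : l = j
      · simp [hlj]
      · have : (l : ℕ) ≠ j := fun hh => hlj (Fin.ext hh)
        by_cases hl : o l = some i <;> simp [this, hlj, hl]
    set y := I.v i (insert j (held o i)) with hy
    have hyG : y ∈ G 0 := hv _ _
    have hxG : I.v i (held o i) ∈ G 0 := hv _ _
    have hmG : ArithOp.sub.value y (I.v i (held o i)) ∈ G 1 :=
      hG.op_mem _ hyG hxG (by omega) (by omega)
    have size0 : ∀ {z}, z ∈ G 0 → w z ≤ W := fun hz => hG.size_le 0 _ (by omega) hz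
    have size1 : ∀ {z}, z ∈ G 1 → w z ≤ W := fun hz => hG.size_le 1 _ (by omega) hz
    refine Meets.natStore (Meets.query ?_ (Meets.natConst (Meets.natStore
      (Meets.realArith ?_ ?_ ?_ ?_))))
    · simp only [Store.setNatArr_natVar, Store.setNat_natVar, hi, hj, hone]
      simp only [Nat.reduceEqDiff, if_false]
      rw [hq]
      exact size0 hyG
    all_goals
      simp only [Store.setNatArr_natVar, Store.setNat_natVar, Store.setNat_realVar,
        Store.setReal_natVar, Store.setNatArr_realVar, Store.setReal_realVar, hi, hj, hone,
        Nat.reduceEqDiff, if_false, if_true,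
        OfNat.one_ne_ofNat, hq, hx]
    · exact size0 hyG
    · exact size0 hxG
    · exact size1 hmG
    set s₁ := (((((s.setNat 13 (s.natArr 1 ↑j)).setNatArr 2 (↑j) 1).setReal 2 y).setNat 13
      0).setNatArr 2 (↑j) 0).setReal 2 (ArithOp.sub.value y (I.v i (held o i))) with hs₁
    have hA₁ : Agree 13 1 2 s s₁ := by
      refine Agree.setReal (Agree.setNatArr (Agree.setNat (Agree.setReal (Agree.setNatArr
        (Agree.setNat (Agree.refl s) ?_) ?_) ?_) ?_) ?_) ?_ <;> omega
    have hx₁ : s₁.realVar 1 = I.v i (held o i) := by simp [hs₁, hx]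
    have hy₁ : s₁.realVar 2 = marginal (I.v i) (held o i) j := by
      simp [hs₁, ArithOp.value, marginal, hy]
    -- Unmarking item `j` restores the bundle, because an available item is not held.
    have hB₁ : HoldsBundle o i s₁ := by
      intro l
      by_cases hlj : l = j
      · subst hlj
        simp [hs₁, hnone]
      · have : (l : ℕ) ≠ j := fun hh => hlj (Fin.ext hh)
        simpa [hs₁, this] using hB l
    have hI₁ := hI.agree hA₁ (by omega)
    have hi₁ : s₁.natVar 5 = i := (hA₁.natVar 5 (by omega)).trans hi
    have hb₁ : s₁.realArr 0 (s₁.natVar 5) = I.b i := by rw [hi₁]; exact hI₁.entitlement i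
    have ht₁ : s₁.realArr 1 (s₁.natVar 5) = t i := by rw [hi₁]; exact hI₁.threshold i
    have hc₁ : s₁.natVar 12 = (held o i).card := (hA₁.natVar 12 (by omega)).trans hcard
    have hspec := hR.price_spec I.oracle w W G hG s₁ (by rw [hb₁]; exact hb i)
      (by rw [ht₁]; exact ht i) (by rw [hx₁]; exact hxG)
      (by rw [hy₁]; exact hmG) hI₁.one
    rw [hb₁, ht₁, hc₁, hx₁, hy₁] at hspec
    refine Meets.seq (N₂ := 20) (Meets.mono hspec le_rfl ?_) (by omega)
    rintro s₂ ⟨hA₂, hp, hpw⟩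
    have hbid : s₂.realVar 3 = R.bid I t i (held o i) j := hp
    have hD₂ : HoldsBest w W (fun i j => R.bid I t i (held o i) j) D s₂ :=
      (hD.agree hA₁ (by omega) (by omega)).agree hA₂ (by omega) (by omega)
    have hA : Agree 13 0 2 s s₂ := (hA₁.mono le_rfl (by omega) le_rfl).trans
      (hA₂.mono le_rfl (by omega) (by omega))
    have hi₂ : s₂.natVar 5 = i := (hA.natVar 5 (by omega)).trans hi
    have hj₂ : s₂.natVar 10 = j := (hA.natVar 10 (by omega)).trans hj
    have hc₂ : s₂.natVar 12 = (held o i).card := (hA.natVar 12 (by omega)).trans hcard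
    have hx₂ : s₂.realVar 1 = I.v i (held o i) := (hA₂.realVar 1 (by omega)).trans hx₁
    have hB₂ : HoldsBundle o i s₂ := by
      intro l
      rw [hA₂.natArr 2 (by omega)]
      exact hB₁ l
    -- The bid is recorded on two paths: when there is no best bid yet, and when it exceeds the old
    -- one.
    have htake : ∀ s₃, Agree 13 3 3 s₂ s₃ → s₃.realVar 3 = R.bid I t i (held o i) j →
        (s₂.natVar 7 ≠ 0 → s₂.realVar 0 ≤ R.bid I t i (held o i) j) →
        Meets I.oracle w W takeCode s₃ 7 fun s' => s'.natVar 10 = j ∧ Agree 7 0 2 s s' ∧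
          s'.natVar 12 = (held o i).card ∧ s'.realVar 1 = I.v i (held o i) ∧
          HoldsBundle o i s' ∧ HoldsBest w W (fun i j => R.bid I t i (held o i) j)
            (fun i' j' => D i' j' ∨ (o j = none ∧ i' = i ∧ j' = j)) s' := by
      intro s₃ hA₃ hb₃ hle
      have hi₃ : s₃.natVar 5 = i := (hA₃.natVar 5 (by omega)).trans hi₂
      have hj₃ : s₃.natVar 10 = j := (hA₃.natVar 10 (by omega)).trans hj₂
      have hc₃ : s₃.natVar 12 = (held o i).card := (hA₃.natVar 12 (by omega)).trans hc₂
      have hx₃ : s₃.realVar 1 = I.v i (held o i) := (hA₃.realVar 1 (by omega)).trans hx₂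
      refine takeCode_spec (N := 0) hG (by rw [hb₃, ← hbid]; exact hpw) ⟨by simpa using hj₃,
        ?_, by simpa using hc₃, by simpa using hx₃, ?_, ?_⟩
      · have h1 : Agree 7 0 2 s s₃ := (hA.mono (by omega) le_rfl le_rfl).trans
          (hA₃.mono (by omega) (by omega) (by omega))
        refine Agree.setNat (Agree.setNat (Agree.setNat (Agree.setNat (Agree.setReal
          (Agree.setReal h1 ?_) ?_) ?_) ?_) ?_) ?_ <;> omega
      · intro l
        have := hB₂ l
        rw [← hA₃.natArr 2 (by omega)] at this
        simpa using this
      · refine (hD₂.insert_new (i := i) (j := j) hle ?_ ?_ ?_ ?_ ?_).congr fun i' j' => by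
          simp [hnone]
        · simp
        · simpa using hi₃
        · simpa using hj₃
        · simpa using hb₃
        · rw [← hbid]; exact hpw
    refine Meets.cond (N := 19) (fun h7 => ?_) fun h7 => ?_
    · have hbest : w (s₂.realVar 0) ≤ W := by
        rcases hD₂ with h | ⟨-, _, _, _, _, _, h0, hw, _⟩
        · exact absurd h.1 h7
        · rw [h0]; exact hw
      refine Meets.realCompare hpw hbest (Meets.cond (fun hle => ?_) fun hlt => ?_)
      · have hle' : s₂.realVar 3 ≤ s₂.realVar 0 := by
          by_contra hh
          simp [hh] at hle
        have hS : Agree 13 3 3 s₂ (s₂.setNat 13 (if s₂.realVar 3 ≤ s₂.realVar 0 then 1 else 0)) :=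
          (Agree.refl s₂).setNat le_rfl
        refine Meets.skip ⟨by simpa using hj₂, ?_, by simpa using hc₂, by simpa using hx₂,
          by simpa [HoldsBundle] using hB₂, ?_⟩
        · exact (hA.mono (by omega) le_rfl le_rfl).trans (hS.mono (by omega) (by omega) (by omega))
        · refine ((hD₂.agree hS (by omega) (by omega)).insert_le (i := i) (j := j)
            (by simpa using h7) ?_).congr fun i' j' => by simp [hnone]
          rw [← hbid]
          simpa using hle'
      · have hlt' : s₂.realVar 0 < s₂.realVar 3 := by
          by_contra hh
          simp [not_lt.1 hh] at hlt
        refine Meets.mono (htake _ ((Agree.refl s₂).setNat le_rfl) (by simpa using hbid)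
          fun _ => ?_) (by omega) fun _ h => h
        rw [← hbid]
        exact hlt'.le
    · exact Meets.mono (htake s₂ (Agree.refl _) hbid fun h => absurd h7 h) (by omega) fun _ h => h

theorem agentCode_spec (hR : R.Correct) (hG : Scale w W G) (hb : ∀ i, I.b i ∈ G 0)
    (ht : ∀ i, t i ∈ G 0) (hv : ∀ i S, I.v i S ∈ G 0) (hI : HoldsInput I t s)
    (ho : HoldsOwners o s) (hi : s.natVar 5 = i) {D : Fin I.n → Fin I.m → Prop}
    (hD : HoldsBest w W (fun i j => R.bid I t i (held o i) j) D s) :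
    Meets I.oracle w W (agentCode R) s (200 * I.m + 200) fun s' => Agree 7 0 2 s s' ∧
      HoldsBest w W (fun i j => R.bid I t i (held o i) j)
        (fun i' j' => D i' j' ∨ (Candidate (R.Active I t) o i' j' ∧ i' = i)) s' := by
  have size0 : ∀ {z}, z ∈ G 0 → w z ≤ W := fun hz => hG.size_le 0 _ (by omega) hz
  simp only [agentCode, instrs]
  refine Meets.seq (N₂ := 176 * I.m + 150) (Meets.mono (markCode_spec hI ho hi) le_rfl ?_)
    (by omega)
  rintro s₁ ⟨hA₁, hc₁, hB₁⟩
  have hI₁ := hI.agree hA₁ (by omega)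
  have hi₁ : s₁.natVar 5 = i := (hA₁.natVar 5 (by omega)).trans hi
  have hq : I.oracle i (s₁.natArr 2) = I.v i (held o i) :=
    oracle_eq i fun j => by rw [hB₁ j, mem_held]; simp
  refine Meets.mono (N := (176 * I.m + 149) + 1) (Meets.query ?_ ?_) le_rfl fun _ h => h
  · rw [hi₁, hq]; exact size0 (hv _ _)
  rw [hi₁, hq]
  set s₂ := s₁.setReal 1 (I.v i (held o i)) with hs₂
  have hA₂ : Agree 13 1 3 s₁ s₂ := (Agree.refl s₁).setReal le_rfl
  have hI₂ := hI₁.agree hA₂ (by omega)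
  have hi₂ : s₂.natVar 5 = i := hi₁
  have hb₂ : s₂.realArr 0 (s₂.natVar 5) = I.b i := by rw [hi₂]; exact hI₂.entitlement i
  have ht₂ : s₂.realArr 1 (s₂.natVar 5) = t i := by rw [hi₂]; exact hI₂.threshold i
  have hspec := hR.goal_spec I.oracle w W G hG s₂ (by rw [hb₂]; exact hb i)
    (by rw [ht₂]; exact ht i)
  rw [hb₂, ht₂] at hspec
  refine Meets.seq (N₂ := 176 * I.m + 40) (Meets.mono hspec le_rfl ?_) (by omega)
  rintro s₃ ⟨hA₃, hg, hgw⟩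
  have hx₃ : s₃.realVar 1 = I.v i (held o i) := by
    rw [hA₃.realVar 1 (by omega), hs₂]; simp
  refine Meets.mono (N := ((176 * I.m + 38) + 1) + 1) (Meets.realCompare hgw
    (by rw [hx₃]; exact size0 (hv _ _)) ?_) le_rfl fun _ h => h
  rw [hg, hx₃]
  set s₄ := s₃.setNat 13 (if R.goal (I.b i) (t i) ≤ I.v i (held o i) then 1 else 0) with hs₄
  have hA₄ : Agree 13 3 3 s₃ s₄ := (Agree.refl s₃).setNat le_rfl
  have hA : Agree 10 1 2 s s₄ := hA₁.trans ((hA₂.mono (by omega) le_rfl (by omega)).trans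
    ((hA₃.trans hA₄).mono (by omega) (by omega) (by omega)))
  have hD₄ := hD.agree hA le_rfl le_rfl
  refine Meets.cond (fun hne => ?_) fun heq => ?_
  · refine Meets.skip ⟨hA.mono (by omega) (by omega) le_rfl, hD₄.congr fun i' j' => ?_⟩
    have : ¬ R.Active I t i (held o i) := by
      intro hh
      simp [hs₄, not_le.2 hh] at hne
    refine ⟨Or.inl, ?_⟩
    rintro (h | ⟨h, rfl⟩)
    · exact h
    · exact absurd h.1 this
  · have hact : R.Active I t i (held o i) := by
      by_contra hh
      simp [hs₄, not_lt.1 hh] at heq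
    have hB₄ : HoldsBundle o i s₄ := by
      intro j
      rw [hA₄.natArr 2 (by omega), hA₃.natArr 2 (by omega), hA₂.natArr 2 (by omega)]
      exact hB₁ j
    have hc₄ : s₄.natVar 12 = (held o i).card := by
      rw [hA₄.natVar 12 (by omega), hA₃.natVar 12 (by omega), hA₂.natVar 12 (by omega), hc₁]
    have hx₄ : s₄.realVar 1 = I.v i (held o i) := (hA₄.realVar 1 (by omega)).trans hx₃
    have key := Meets.forLoop (q := I.oracle) (w := w) (W := W) (N := 130) (c := 10) (d := 11)
      (lim := 1) (one := 2) (M := I.m) (s := s₄) (body := probeCode R)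
      (fun k s' => Agree 7 0 2 s₄ s' ∧ s'.natVar 12 = (held o i).card ∧
        s'.realVar 1 = I.v i (held o i) ∧ HoldsBundle o i s' ∧
        HoldsBest w W (fun i j => R.bid I t i (held o i) j)
          (fun i' j' => D i' j' ∨ (o j' = none ∧ i' = i ∧ (j' : ℕ) < k)) s')
      (by decide) (by decide) ?_ ?_ ?_ ?_
    · refine Meets.mono key (by omega) ?_
      rintro s' ⟨h1, -, -, -, h2⟩
      refine ⟨(hA.mono (by omega) (by omega) le_rfl).trans h1, h2.congr fun i' j' => ?_⟩
      refine or_congr_right ⟨?_, ?_⟩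
      · rintro ⟨h3, rfl, -⟩
        exact ⟨⟨hact, h3⟩, rfl⟩
      · rintro ⟨h3, rfl⟩
        exact ⟨h3.2, rfl, j'.2⟩
    · have hst : ∀ k s' x y, 10 ≤ x → x ≠ 12 → (Agree 7 0 2 s₄ s' ∧
          s'.natVar 12 = (held o i).card ∧
          s'.realVar 1 = I.v i (held o i) ∧ HoldsBundle o i s' ∧
          HoldsBest w W (fun i j => R.bid I t i (held o i) j)
            (fun i' j' => D i' j' ∨ (o j' = none ∧ i' = i ∧ (j' : ℕ) < k)) s') →
          (Agree 7 0 2 s₄ (s'.setNat x y) ∧ (s'.setNat x y).natVar 12 = (held o i).card ∧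
          (s'.setNat x y).realVar 1 = I.v i (held o i) ∧ HoldsBundle o i (s'.setNat x y) ∧
          HoldsBest w W (fun i j => R.bid I t i (held o i) j)
            (fun i' j' => D i' j' ∨ (o j' = none ∧ i' = i ∧ (j' : ℕ) < k)) (s'.setNat x y)) := by
        rintro k s' x y hx hx' ⟨h1, h2, h3, h4, h5⟩
        refine ⟨h1.setNat (by omega), ?_, h3, h4, h5.agree
          ((Agree.refl s').setNat (a := 10) (b := 1) (c := 0) hx) le_rfl le_rfl⟩
        rw [Store.setNat_natVar, if_neg (Ne.symm hx'), h2]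
      exact fun k s' x h => ⟨hst _ _ _ _ (by omega) (by omega) h,
        hst _ _ _ _ (by omega) (by omega) h⟩
    · rintro k s' ⟨h1, -⟩
      have h2 := ((hI.agree hA (by omega)).agree h1 (by omega))
      exact ⟨h2.items, h2.one⟩
    · rintro k s' hk hck ⟨h1, h2, h3, h4, h5⟩
      have hA' : Agree 7 0 2 s s' := (hA.mono (by omega) (by omega) le_rfl).trans h1
      refine Meets.mono (probeCode_spec hR hG hb ht hv (hI.agree hA' (by omega))
        (ho.agree hA' le_rfl) ((hA'.natVar 5 (by omega)).trans hi) ⟨k, hk⟩ hck h2 h3 h4 h5) le_rfl ?_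
      rintro s'' ⟨h6, h7, h8, h9, h10, h11⟩
      refine ⟨h6, h1.trans h7, h8, h9, h10, h11.congr fun i' j' => ?_⟩
      rw [or_assoc]
      refine or_congr_right ⟨?_, ?_⟩
      · rintro (⟨h12, h13, h14⟩ | ⟨h12, h13, rfl⟩)
        · exact ⟨h12, h13, by omega⟩
        · exact ⟨h12, h13, Nat.lt_succ_self k⟩
      · rintro ⟨h12, h13, h14⟩
        rcases Nat.lt_succ_iff_lt_or_eq.1 h14 with h15 | h15
        · exact Or.inl ⟨h12, h13, h15⟩
        · have : j' = ⟨k, hk⟩ := Fin.ext h15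
          exact Or.inr ⟨this ▸ h12, h13, this⟩
    · exact ⟨Agree.refl _, hc₄, hx₄, hB₄, hD₄.congr fun i' j' => by simp⟩

/-- After the loop over all agents the compared pairs are exactly the candidates, so a recorded best
pair is a witness for `sell`, and an unset flag one for `idle`. -/
theorem roundCode_spec (hR : R.Correct) (hG : Scale w W G) (hb : ∀ i, I.b i ∈ G 0)
    (ht : ∀ i, t i ∈ G 0) (hv : ∀ i S, I.v i S ∈ G 0) (hI : HoldsInput I t s)
    (ho : HoldsOwners o s) {k : ℕ} {π : Fin I.m → ℝ}
    (h : Auction (R.Active I t) (R.bid I t) k o π) :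
    Meets I.oracle w W (roundCode R) s (I.n * (200 * I.m + 204) + 10) fun s' =>
      Agree 5 0 0 s s' ∧ ∃ o' π', Auction (R.Active I t) (R.bid I t) (k + 1) o' π' ∧
        HoldsOwners o' s' := by
  simp only [roundCode, instrs]
  have key := Meets.forLoop (q := I.oracle) (w := w) (W := W) (N := 200 * I.m + 200) (c := 5)
    (d := 6) (lim := 0) (one := 2) (M := I.n) (s := s.setNat 7 0) (body := agentCode R)
    (fun k s' => Agree 5 0 2 s s' ∧ HoldsBest w W (fun i j => R.bid I t i (held o i) j)
        (fun i' j' => Candidate (R.Active I t) o i' j' ∧ (i' : ℕ) < k) s')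
    (by decide) (by decide) ?_ ?_ ?_ ?_
  · refine Meets.natConst (Meets.seq (N₁ := I.n * (200 * I.m + 204) + 3) (N₂ := 6)
      (Meets.mono key le_rfl ?_) (by omega))
    rintro s₁ ⟨hA₁, hD⟩
    have ho₁ := ho.agree hA₁ le_rfl
    have hI₁ := hI.agree hA₁ (by omega)
    rcases hD with ⟨h7, hD⟩ | ⟨h7, i, j, hc, h8, h9, -, -, hmax⟩
    · refine Meets.cond (fun hne => absurd h7 hne) fun _ => Meets.skip
        ⟨hA₁.mono le_rfl le_rfl (by omega), o, π, .idle h fun i j hc => hD i j ⟨hc, i.2⟩, ho₁⟩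
    · refine Meets.cond (fun _ => ?_) fun heq => by omega
      refine Meets.natAdd (Meets.natStore (Meets.natStore (Meets.skip ⟨?_, _, _,
        .sell h i j hc.1 fun i' j' hc' => hmax i' j' ⟨hc', i'.2⟩, ?_⟩)))
      · exact (((hA₁.mono le_rfl le_rfl (by omega)).setNat (by omega)).setNatArr
          (by omega)).setNatArr (by omega)
      · intro l
        by_cases hlj : l = j
        · subst hlj
          simp [h9, h8, hI₁.one]
        · have : (l : ℕ) ≠ j := fun hh => hlj (Fin.ext hh)
          simpa [h9, this, hlj] using ho₁ l
  · rintro k s' x ⟨h1, h2⟩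
    refine ⟨⟨h1.setNat (by omega), ?_⟩, ⟨h1.setNat (by omega), ?_⟩⟩ <;>
      simpa [HoldsBest] using h2
  · rintro k s' ⟨h1, -⟩
    have := hI.agree h1 (by omega)
    exact ⟨this.agents, this.one⟩
  · rintro k s' hk hck ⟨h1, h2⟩
    refine Meets.mono (agentCode_spec (i := ⟨k, hk⟩) hR hG hb ht hv (hI.agree h1 (by omega))
      (ho.agree h1 le_rfl) hck h2) le_rfl ?_
    rintro s'' ⟨h3, h4⟩
    refine ⟨(h3.natVar 5 (by omega)).trans hck,
      h1.trans (h3.mono (by omega) le_rfl le_rfl), h4.congr fun i' j' => ?_⟩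
    rw [← and_or_left]
    refine and_congr_right fun _ => ⟨?_, fun h5 => ?_⟩
    · rintro (h5 | rfl)
      · omega
      · exact Nat.lt_succ_self k
    · rcases Nat.lt_succ_iff_lt_or_eq.1 h5 with h6 | h6
      · exact Or.inl h6
      · exact Or.inr (Fin.ext h6)
  · exact ⟨(Agree.refl s).setNat (by omega), Or.inl ⟨by simp, by simp⟩⟩

/-- The number of steps of the auction program. -/
def auctionSteps (n m : ℕ) : ℕ := m * (n * (200 * m + 204) + 14) + 4

theorem BiddingRule.Correct.program_spec (hR : R.Correct) (hG : Scale w W G)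
    (hb : ∀ i, I.b i ∈ G 0) (ht : ∀ i, t i ∈ G 0) (hv : ∀ i S, I.v i S ∈ G 0) :
    Meets I.oracle w W R.program (I.input t) (auctionSteps I.n I.m) fun s' =>
      ∃ o π, Auction (R.Active I t) (R.bid I t) I.m o π ∧ HoldsOwners o s' := by
  simp only [BiddingRule.program, instrs]
  have key := Meets.forLoop (q := I.oracle) (w := w) (W := W)
    (N := I.n * (200 * I.m + 204) + 10) (c := 3) (d := 4) (lim := 1) (one := 2) (M := I.m)
    (s := (I.input t).setNat 2 1) (body := roundCode R)
    (fun k s' => HoldsInput I t s' ∧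
      ∃ o π, Auction (R.Active I t) (R.bid I t) k o π ∧ HoldsOwners o s')
    (by decide) (by decide) ?_ ?_ ?_ ?_
  · exact Meets.natConst (Meets.mono key le_rfl fun s' h => h.2)
  · rintro k s' x ⟨h1, h2⟩
    exact ⟨⟨h1.agree ((Agree.refl s').setNat (a := 3) (b := 0) (c := 0) (by omega)) le_rfl, h2⟩,
      ⟨h1.agree ((Agree.refl s').setNat (a := 3) (b := 0) (c := 0) (by omega)) le_rfl, h2⟩⟩
  · rintro k s' ⟨h1, -⟩
    exact ⟨h1.items, h1.one⟩
  · rintro k s' hk hck ⟨h1, o, π, h2, h3⟩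
    refine Meets.mono (roundCode_spec hR hG hb ht hv h1 h3 h2) le_rfl ?_
    rintro s'' ⟨h4, h5⟩
    exact ⟨(h4.natVar 3 (by omega)).trans hck, h1.agree h4 (by omega), h5⟩
  · refine ⟨⟨?_, ?_, ?_, ?_, ?_⟩, _, _, .start, fun j => ?_⟩ <;>
      simp [AllocationInstance.input]

end Program

/-! ## The bidding rules as programs -/

section Code

variable {q : Oracle} {w : ℝ → ℕ} {W N : ℕ} {G : ℕ → Set ℝ} {U : Program} {s : Store}
  {Q : Store → Prop} {x y z d e : ℕ} {a b : ℝ}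

theorem Scale.op_mem_max (hG : Scale w W G) (op : ArithOp) (ha : a ∈ G d) (hb : b ∈ G e) :
    op.value a b ∈ G (max d e + 1) :=
  hG.op_mem op ha hb (by omega) (by omega)

theorem Scale.realConst (hG : Scale w W G) (k : ℕ) (hk : k ≤ 270)
    (h : Meets q w W U (s.setReal x k) N Q) :
    Meets q w W (.seq (.instr (.realConst x k)) U) s (N + 1) Q :=
  Meets.realConst (hG.size_le 0 _ (by omega) (hG.nat k hk)) h

theorem Scale.realLoad (hG : Scale w W G) {c : ℕ} (ha : s.realArr c (s.natVar y) = a)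
    (ha' : a ∈ G d) (hd : d ≤ 12) (h : Meets q w W U (s.setReal x a) N Q) :
    Meets q w W (.seq (.instr (.realLoad x c y)) U) s (N + 1) Q := by
  subst ha
  exact Meets.realLoad (hG.size_le d _ hd ha') h

theorem Scale.realArith (hG : Scale w W G) {op : ArithOp} (ha' : a ∈ G d) (hb' : b ∈ G e)
    (ha : s.realVar y = a) (hb : s.realVar z = b) (hd : d ≤ 11) (he : e ≤ 11)
    (h : Meets q w W U (s.setReal x (op.value a b)) N Q) :
    Meets q w W (.seq (.instr (.realArith op x y z)) U) s (N + 1) Q := by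
  subst ha hb
  exact Meets.realArith (hG.size_le d _ (by omega) ha') (hG.size_le e _ (by omega) hb')
    (hG.size_le _ _ (by omega) (hG.op_mem_max op ha' hb')) h

theorem Scale.realCompare (hG : Scale w W G) (ha' : a ∈ G d) (hb' : b ∈ G e)
    (ha : s.realVar y = a) (hb : s.realVar z = b) (hd : d ≤ 12) (he : e ≤ 12)
    (h : Meets q w W U (s.setNat x (if a ≤ b then 1 else 0)) N Q) :
    Meets q w W (.seq (.instr (.realCompare x y z)) U) s (N + 1) Q := by
  subst ha hb
  exact Meets.realCompare (hG.size_le d _ hd ha') (hG.size_le e _ he hb') h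

/-- Set the real variable `x` to the minimum of the real variables `y` and `z`. -/
def minCode (x y z : ℕ) : Program :=
  instrs [.realConst 11 0, .realCompare 13 y z]
    (.seq (.cond 13 (instrs [.realArith .add x y 11] .skip)
      (instrs [.realArith .add x z 11] .skip)) .skip)

theorem Scale.minCode (hG : Scale w W G) (ha' : a ∈ G d) (hb' : b ∈ G e)
    (ha : s.realVar y = a) (hb : s.realVar z = b) (hd : d ≤ 11) (he : e ≤ 11)
    (hy : y ≠ 11) (hz : z ≠ 11)
    (h : Meets q w W U (((s.setReal 11 ((0 : ℕ) : ℝ)).setNat 13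
      (if a ≤ b then 1 else 0)).setReal x (min a b)) N Q) :
    Meets q w W (.seq (minCode x y z) U) s (N + 6) Q := by
  have h0 := hG.nat 0 (by omega)
  simp only [FairAllocation.minCode, instrs]
  refine Meets.seq_assoc (hG.realConst 0 (by omega) (Meets.seq_assoc (hG.realCompare ha' hb'
    (by simp [hy, ha]) (by simp [hz, hb]) (by omega) (by omega) (Meets.seq_assoc
      (Meets.seq_cond (fun hne => ?_) fun heq => ?_)))))
  · have hle : a ≤ b := by
      by_contra hh
      simp [hh] at hne
    refine Meets.seq_assoc (hG.realArith (b := ((0 : ℕ) : ℝ)) ha' h0 (by simp [hy, ha]) (by simp)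
      hd (by omega) (Meets.seq_skip (Meets.seq_skip ?_)))
    simpa [ArithOp.value, hle] using h
  · have hle : b ≤ a := by
      by_contra hh
      simp [(not_le.1 hh).le] at heq
    refine Meets.seq_assoc (hG.realArith (b := ((0 : ℕ) : ℝ)) hb' h0 (by simp [hz, hb]) (by simp)
      he (by omega) (Meets.seq_skip (Meets.seq_skip ?_)))
    simpa [ArithOp.value, hle] using h

end Code

/-- The bidding rule for the AnyPrice share. -/
noncomputable def apsRule : BiddingRule where
  goal b t := t / (3 - 2 * b)
  price b t c _ y := apsBid b (t / (3 - 2 * b)) c y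
  goalCode := instrs [.realLoad 5 0 5, .realLoad 6 1 5, .realConst 7 3, .realConst 8 2,
    .realArith .mul 8 8 5, .realArith .sub 7 7 8, .realArith .div 4 6 7] .skip
  priceCode := instrs [.realLoad 5 0 5, .realLoad 6 1 5, .realConst 7 3, .realConst 8 2,
    .realArith .mul 9 8 5, .realArith .sub 7 7 9, .realArith .div 6 6 7,
    .realArith .mul 8 8 6, .realArith .div 8 5 8, .realArith .mul 3 8 2]
    -- The linear bid is computed in any case and overwritten only for a large first item.
    (.cond 12 .skip (instrs [.realCompare 13 6 2]
      (.cond 13 (instrs [.realConst 7 0, .realArith .add 3 5 7] .skip) .skip)))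

/-- The facts `h1`, `h2`, … place the intermediate results on the scale; the code is then executed
symbolically, one instruction per step. -/
theorem apsRule_correct : apsRule.Correct where
  goal_spec q w W G hG s hb ht := by
    simp only [apsRule, instrs]
    set b := s.realArr 0 (s.natVar 5) with hb_def
    set t := s.realArr 1 (s.natVar 5) with ht_def
    have h1 := hG.op_mem_max .mul (hG.nat 2 (by omega)) hb
    have h2 := hG.op_mem_max .sub (hG.nat 3 (by omega)) h1
    have h3 := hG.op_mem_max .div ht h2
    refine hG.realLoad (a := b) (by simp [hb_def]) hb (by omega) ?_
    refine hG.realLoad (a := t) (by simp [ht_def]) ht (by omega) ?_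
    refine hG.realConst 3 (by omega) (hG.realConst 2 (by omega) ?_)
    refine hG.realArith (hG.nat 2 (by omega)) hb (by simp) (by simp) (by omega) (by omega) ?_
    refine hG.realArith (hG.nat 3 (by omega)) h1 (by simp) (by simp) (by omega) (by omega) ?_
    refine hG.realArith ht h2 (by simp) (by simp) (by omega) (by omega) ?_
    refine Meets.skip ⟨?_, ?_, ?_⟩
    · repeat' refine Agree.setReal ?_ (by omega)
      exact Agree.refl s
    · simp [ArithOp.value]
    · simpa using hG.size_le _ _ (by omega) h3
  price_spec q w W G hG s hb ht hx hy hone := by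
    simp only [apsRule, instrs]
    set b := s.realArr 0 (s.natVar 5) with hb_def
    set t := s.realArr 1 (s.natVar 5) with ht_def
    set y := s.realVar 2 with hy_def
    have h1 := hG.op_mem_max .mul (hG.nat 2 (by omega)) hb
    have h2 := hG.op_mem_max .sub (hG.nat 3 (by omega)) h1
    have h3 := hG.op_mem_max .div ht h2
    have h4 := hG.op_mem_max .mul (hG.nat 2 (by omega)) h3
    have h5 := hG.op_mem_max .div hb h4
    have h6 := hG.op_mem_max .mul h5 hy
    refine hG.realLoad (a := b) (by simp [hb_def]) hb (by omega) ?_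
    refine hG.realLoad (a := t) (by simp [ht_def]) ht (by omega) ?_
    refine hG.realConst 3 (by omega) (hG.realConst 2 (by omega) ?_)
    refine hG.realArith (hG.nat 2 (by omega)) hb (by simp) (by simp) (by omega) (by omega) ?_
    refine hG.realArith (hG.nat 3 (by omega)) h1 (by simp) (by simp) (by omega) (by omega) ?_
    refine hG.realArith ht h2 (by simp) (by simp) (by omega) (by omega) ?_
    refine hG.realArith (hG.nat 2 (by omega)) h3 (by simp) (by simp) (by omega) (by omega) ?_
    refine hG.realArith hb h4 (by simp) (by simp) (by omega) (by omega) ?_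
    refine hG.realArith h5 hy (by simp) (by simp [hy_def]) (by omega) (by omega) ?_
    refine Meets.cond (fun hc => ?_) fun hc => ?_
    · simp only [Store.setReal_natVar] at hc
      refine Meets.skip ⟨?_, ?_, ?_⟩
      · repeat' refine Agree.setReal ?_ (by omega)
        exact Agree.refl s
      · simp [ArithOp.value, apsBid, hc]
      · simpa using hG.size_le _ _ (by omega) h6
    · simp only [Store.setReal_natVar] at hc
      refine hG.realCompare h3 hy (by simp) (by simp [hy_def]) (by omega) (by omega)
        (Meets.cond (fun hle => ?_) fun hle => ?_)
      · have hle' : t / (3 - 2 * b) ≤ y := by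
          by_contra hh
          simp [ArithOp.value, hh] at hle
        refine hG.realConst 0 (by omega) (hG.realArith hb (hG.nat 0 (by omega)) (by simp) (by simp)
          (by omega) (by omega) (Meets.skip ⟨?_, ?_, ?_⟩))
        · refine Agree.setReal (Agree.setReal (Agree.setNat ?_ ?_) ?_) ?_ <;> try omega
          repeat' refine Agree.setReal ?_ (by omega)
          exact Agree.refl s
        · simp [ArithOp.value, apsBid, hc, hle']
        · simpa [ArithOp.value] using hG.size_le _ _ (by omega) hb
      · have hle' : ¬ t / (3 - 2 * b) ≤ y := by
          intro hh
          simp [ArithOp.value, hh] at hle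
        refine Meets.skip ⟨?_, ?_, ?_⟩
        · refine Agree.setNat ?_ (by omega)
          repeat' refine Agree.setReal ?_ (by omega)
          exact Agree.refl s
        · simp [ArithOp.value, apsBid, hc, hle']
        · simpa using hG.size_le _ _ (by omega) h6

/-- The bidding rule for the maximin share. -/
noncomputable def mmsRule : BiddingRule where
  -- For `b = 1 / n` this is `ρ * t / 27` with `ρ = 10 + 1 / (10 * n)`; the factor `27 / t` in the
  -- price normalizes the values.
  goal b t := (10 / 27 + b / 270) * t
  price b t c x y := mmsBid (10 + b / 10) c (27 * x / t) (27 * y / t)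
  goalCode := instrs [.realLoad 5 0 5, .realLoad 6 1 5, .realConst 7 10, .realConst 8 27,
    .realArith .div 7 7 8, .realConst 8 270, .realArith .div 8 5 8, .realArith .add 7 7 8,
    .realArith .mul 4 7 6] .skip
  priceCode := instrs [.realLoad 5 0 5, .realLoad 6 1 5, .realConst 7 27, .realArith .mul 8 7 2,
    .realArith .div 8 8 6, .realArith .mul 9 7 1, .realArith .div 9 9 6, .realConst 7 10,
    .realArith .div 10 5 7, .realArith .add 10 7 10, .realConst 7 7]
    (.seq (minCode 3 8 7) (.cond 12
      -- Variable 2 holds `1`, so the difference is nonzero exactly when at least two items are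
      -- held.
      (instrs [.natSub 13 12 2] (.cond 13
        (instrs [.realConst 5 28, .realConst 6 3, .realArith .div 5 5 6, .realCompare 13 5 9]
          (.cond 13
            (instrs [.realConst 6 4, .realArith .div 6 7 6, .realArith .mul 6 6 8,
              .realConst 5 2, .realArith .div 5 7 5] (.seq (minCode 3 6 5) .skip))
            .skip))
        .skip))
      (instrs [.realCompare 13 10 8] (.cond 13 (instrs [.realConst 3 14] .skip) .skip))))

theorem mmsRule_correct : mmsRule.Correct where
  goal_spec q w W G hG s hb ht := by
    simp only [mmsRule, instrs]
    set b := s.realArr 0 (s.natVar 5) with hb_def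
    set t := s.realArr 1 (s.natVar 5) with ht_def
    have h1 := hG.op_mem_max .div (hG.nat 10 (by omega)) (hG.nat 27 (by omega))
    have h2 := hG.op_mem_max .div hb (hG.nat 270 (by omega))
    have h3 := hG.op_mem_max .add h1 h2
    have h4 := hG.op_mem_max .mul h3 ht
    refine hG.realLoad (a := b) (by simp [hb_def]) hb (by omega) ?_
    refine hG.realLoad (a := t) (by simp [ht_def]) ht (by omega) ?_
    refine hG.realConst 10 (by omega) (hG.realConst 27 (by omega) ?_)
    refine hG.realArith (hG.nat 10 (by omega)) (hG.nat 27 (by omega)) (by simp) (by simp)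
      (by omega) (by omega) ?_
    refine hG.realConst 270 (by omega) ?_
    refine hG.realArith hb (hG.nat 270 (by omega)) (by simp) (by simp) (by omega) (by omega) ?_
    refine hG.realArith h1 h2 (by simp) (by simp) (by omega) (by omega) ?_
    refine hG.realArith h3 ht (by simp) (by simp) (by omega) (by omega) ?_
    refine Meets.skip ⟨?_, ?_, ?_⟩
    · repeat' refine Agree.setReal ?_ (by omega)
      exact Agree.refl s
    · simp [ArithOp.value]
    · simpa using hG.size_le _ _ (by omega) h4
  price_spec q w W G hG s hb ht hx hy hone := by
    simp only [mmsRule, instrs]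
    set b := s.realArr 0 (s.natVar 5) with hb_def
    set t := s.realArr 1 (s.natVar 5) with ht_def
    set x := s.realVar 1 with hx_def
    set y := s.realVar 2 with hy_def
    have h27 := hG.nat 27 (by omega)
    have h10 := hG.nat 10 (by omega)
    have h7 := hG.nat 7 (by omega)
    have hY1 := hG.op_mem_max .mul h27 hy
    have hY := hG.op_mem_max .div hY1 ht
    have hX1 := hG.op_mem_max .mul h27 hx
    have hX := hG.op_mem_max .div hX1 ht
    have hr1 := hG.op_mem_max .div hb h10
    have hr := hG.op_mem_max .add h10 hr1
    refine hG.realLoad (a := b) (by simp [hb_def]) hb (by omega) ?_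
    refine hG.realLoad (a := t) (by simp [ht_def]) ht (by omega) ?_
    refine hG.realConst 27 (by omega) ?_
    refine hG.realArith h27 hy (by simp) (by simp [hy_def]) (by omega) (by omega) ?_
    refine hG.realArith hY1 ht (by simp) (by simp) (by omega) (by omega) ?_
    refine hG.realArith h27 hx (by simp) (by simp [hx_def]) (by omega) (by omega) ?_
    refine hG.realArith hX1 ht (by simp) (by simp) (by omega) (by omega) ?_
    refine hG.realConst 10 (by omega) ?_
    refine hG.realArith hb h10 (by simp) (by simp) (by omega) (by omega) ?_
    refine hG.realArith h10 hr1 (by simp) (by simp) (by omega) (by omega) ?_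
    refine hG.realConst 7 (by omega) ?_
    set Y := ArithOp.div.value (ArithOp.mul.value ((27 : ℕ) : ℝ) y) t with hY_def
    set X := ArithOp.div.value (ArithOp.mul.value ((27 : ℕ) : ℝ) x) t with hX_def
    set r := ArithOp.add.value ((10 : ℕ) : ℝ) (ArithOp.div.value b ((10 : ℕ) : ℝ)) with hr_def
    have hprice : mmsBid (10 + b / 10) (s.natVar 12) (27 * x / t) (27 * y / t) =
        mmsBid r (s.natVar 12) X Y := by
      simp [hY_def, hX_def, hr_def, ArithOp.value]
    rw [hprice]
    refine hG.minCode hY h7 (by simp) (by simp) (by omega) (by omega) (by omega)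
      (by omega) ?_
    generalize hs₁ : Store.setReal (Store.setNat _ 13 _) 3 _ = s₁
    have hA : Agree 13 3 3 s s₁ := by
      rw [← hs₁]
      refine Agree.setReal (Agree.setNat ?_ (by omega)) (by omega)
      repeat' refine Agree.setReal ?_ (by omega)
      exact Agree.refl s
    have hc : s₁.natVar 12 = s.natVar 12 := hA.natVar 12 (by norm_num)
    have hone₁ : s₁.natVar 2 = 1 := (hA.natVar 2 (by omega)).trans hone
    have h3₁ : s₁.realVar 3 = min Y 7 := by rw [← hs₁]; simp
    have h7₁ : s₁.realVar 7 = ((7 : ℕ) : ℝ) := by rw [← hs₁]; simp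
    have h8₁ : s₁.realVar 8 = Y := by rw [← hs₁]; simp
    have h9₁ : s₁.realVar 9 = X := by rw [← hs₁]; simp
    have h10₁ : s₁.realVar 10 = r := by rw [← hs₁]; simp
    have hmin : w (min Y 7) ≤ W := by
      rcases min_choice Y 7 with h | h <;> rw [h]
      · exact hG.size_le _ _ (by omega) hY
      · exact hG.size_le 0 _ (by omega) (by simpa using h7)
    clear_value Y X r
    clear hs₁ hprice hY_def hX_def hr_def
    refine Meets.mono (N := 40) ?_ (by norm_num) fun _ h => h
    refine Meets.cond (fun hne => ?_) fun heq => ?_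
    · rw [hc] at hne
      refine Meets.natSub (Meets.cond (fun h2 => ?_) fun h2 => ?_)
      · have hc2 : 2 ≤ s.natVar 12 := by
          simp [hc, hone₁] at h2
          omega
        have h28 := hG.nat 28 (by omega)
        have hq1 := hG.op_mem_max .div h28 (hG.nat 3 (by omega))
        refine hG.realConst 28 (by omega) (hG.realConst 3 (by omega) ?_)
        refine hG.realArith h28 (hG.nat 3 (by omega)) (by simp) (by simp) (by omega) (by omega) ?_
        refine hG.realCompare hq1 hX (by simp) (by simp [h9₁]) (by omega) (by omega) ?_
        refine Meets.cond (fun hle => ?_) fun hle => ?_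
        · have hle' : 28 / 3 ≤ X := by
            by_contra hh
            simp [ArithOp.value, hh] at hle
          have hm1 := hG.op_mem_max .div h7 (hG.nat 4 (by omega))
          have hm2 := hG.op_mem_max .mul hm1 hY
          have hm3 := hG.op_mem_max .div h7 (hG.nat 2 (by omega))
          refine hG.realConst 4 (by omega) ?_
          refine hG.realArith h7 (hG.nat 4 (by omega)) (by simp [h7₁]) (by simp) (by omega)
            (by omega) ?_
          refine hG.realArith hm1 hY (by simp) (by simp [h8₁]) (by omega) (by omega) ?_
          refine hG.realConst 2 (by omega) ?_
          refine hG.realArith h7 (hG.nat 2 (by omega)) (by simp [h7₁]) (by simp) (by omega)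
            (by omega) ?_
          refine hG.minCode hm2 hm3 (by simp) (by simp) (by omega) (by omega) (by omega)
            (by omega) (Meets.mono (N := 1) (Meets.skip ⟨?_, ?_, ?_⟩) (by omega) fun _ h => h)
          · refine Agree.setReal (Agree.setNat ?_ (by omega)) (by omega)
            repeat' refine Agree.setReal ?_ (by omega)
            refine Agree.setNat ?_ (by omega)
            repeat' refine Agree.setReal ?_ (by omega)
            exact hA.setNat (by omega)
          · rw [mmsBid_late ⟨hc2, hle'⟩]
            simp [ArithOp.value]
          · simp only [Store.setReal_realVar, if_true]
            rcases min_choice (ArithOp.mul.value (ArithOp.div.value ((7 : ℕ) : ℝ) ((4 : ℕ) : ℝ)) Y)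
              (ArithOp.div.value ((7 : ℕ) : ℝ) ((2 : ℕ) : ℝ)) with h | h <;> rw [h]
            · exact hG.size_le _ _ (by omega) hm2
            · exact hG.size_le _ _ (by omega) hm3
        · have hle' : ¬ 28 / 3 ≤ X := by
            intro hh
            simp [ArithOp.value, hh] at hle
          refine Meets.skip ⟨?_, ?_, ?_⟩
          · refine Agree.setNat ?_ (by omega)
            repeat' refine Agree.setReal ?_ (by omega)
            exact hA.setNat (by omega)
          · rw [mmsBid_early (fun h => hle' h.2) fun h => absurd h hne]
            simp [h3₁]
          · simpa [h3₁] using hmin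
      · have hc2 : ¬ 2 ≤ s.natVar 12 := by
          simp [hc, hone₁] at h2
          omega
        refine Meets.skip ⟨hA.setNat (by omega), ?_, ?_⟩
        · rw [mmsBid_early (fun h => hc2 h.1) fun h => absurd h hne]
          simp [h3₁]
        · simpa [h3₁] using hmin
    · rw [hc] at heq
      refine hG.realCompare hr hY h10₁ h8₁ (by omega) (by omega)
        (Meets.cond (fun hle => ?_) fun hle => ?_)
      · have hle' : r ≤ Y := by
          by_contra hh
          simp [hh] at hle
        refine hG.realConst 14 (by omega) (Meets.skip ⟨?_, ?_, ?_⟩)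
        · exact (hA.setNat (by omega)).setReal (by omega)
        · rw [heq, mmsBid_large hle']
          simp
        · simpa using hG.size_le _ _ (by omega) (hG.nat 14 (by omega))
      · have hle' : Y < r := by
          by_contra hh
          simp [not_lt.1 hh] at hle
        refine Meets.skip ⟨hA.setNat (by omega), ?_, ?_⟩
        · rw [mmsBid_early (fun h => by have := h.1; omega) fun _ => hle']
          simp [h3₁]
        · simpa [h3₁] using hmin

/-! ## Bit lengths of rational numbers -/

theorem natSize_mul_le (a b : ℕ) : Nat.size (a * b) ≤ Nat.size a + Nat.size b := by
  rw [Nat.size_le, pow_add]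
  exact Nat.mul_lt_mul'' (Nat.lt_size_self a) (Nat.lt_size_self b)

theorem natSize_add_le (a b : ℕ) : Nat.size (a + b) ≤ max (Nat.size a) (Nat.size b) + 1 := by
  rw [Nat.size_le, pow_succ, mul_two]
  exact add_lt_add
    ((Nat.lt_size_self a).trans_le (Nat.pow_le_pow_right (by omega) (le_max_left _ _)))
    ((Nat.lt_size_self b).trans_le (Nat.pow_le_pow_right (by omega) (le_max_right _ _)))

/-- Reducing a fraction shrinks numerator and denominator; the extra `1` pays for the denominator of
zero. -/
theorem ratBits_div_le (a b : ℤ) :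
    ratBits ((a : ℚ) / b) ≤ Nat.size a.natAbs + Nat.size b.natAbs + 1 := by
  by_cases ha : a = 0
  · subst ha; simp [ratBits]
  by_cases hb : b = 0
  · subst hb; simp [ratBits]
  rw [← Rat.divInt_eq_div, ratBits]
  have h1 := Nat.size_le_size (Int.natAbs_le_of_dvd_ne_zero (Rat.num_dvd a hb) ha)
  have h2 := Int.natAbs_le_of_dvd_ne_zero (Rat.den_dvd a b) hb
  have h3 := Nat.size_le_size h2
  rw [Int.natAbs_natCast] at h3
  omega

theorem ratBits_natCast (k : ℕ) : ratBits k = Nat.size k + 1 := by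
  simp [ratBits]

/-- The arithmetic operations on rationals. -/
def ArithOp.ratValue : ArithOp → ℚ → ℚ → ℚ
  | .add, x, y => x + y
  | .sub, x, y => x - y
  | .mul, x, y => x * y
  | .div, x, y => x / y

theorem ArithOp.value_ratCast (op : ArithOp) (x y : ℚ) :
    op.value (x : ℝ) (y : ℝ) = (op.ratValue x y : ℚ) := by
  cases op <;> simp [ArithOp.value, ArithOp.ratValue]

/-- Before reduction, numerator and denominator are products, or sums of two products, of numbers of
size at most `l`. -/
theorem ArithOp.ratBits_ratValue_le (op : ArithOp) {x y : ℚ} {l : ℕ} (hx : ratBits x ≤ l)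
    (hy : ratBits y ≤ l) (hl : 2 ≤ l) : ratBits (op.ratValue x y) ≤ 6 * l := by
  have hxd : (x.den : ℚ) ≠ 0 := by exact_mod_cast x.den_nz
  have hyd : (y.den : ℚ) ≠ 0 := by exact_mod_cast y.den_nz
  unfold ratBits at hx hy
  have h1 := natSize_mul_le x.num.natAbs y.den
  have h2 := natSize_mul_le y.num.natAbs x.den
  have h3 := natSize_mul_le x.den y.den
  have h4 := natSize_mul_le x.num.natAbs y.num.natAbs
  have h5 := natSize_add_le (x.num.natAbs * y.den) (y.num.natAbs * x.den)
  have h6 := natSize_mul_le x.den y.num.natAbs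
  have habs₁ : (x.num * y.den + y.num * x.den : ℤ).natAbs ≤
      x.num.natAbs * y.den + y.num.natAbs * x.den := by
    refine (Int.natAbs_add_le _ _).trans ?_
    simp [Int.natAbs_mul]
  have habs₂ : (x.num * y.den - y.num * x.den : ℤ).natAbs ≤
      x.num.natAbs * y.den + y.num.natAbs * x.den := by
    refine (Int.natAbs_sub_le _ _).trans ?_
    simp [Int.natAbs_mul]
  cases op with
  | add =>
    have e : x + y = ((x.num * y.den + y.num * x.den : ℤ) : ℚ) / ((x.den * y.den : ℤ) : ℚ) := by
      conv_lhs => rw [← Rat.num_div_den x, ← Rat.num_div_den y]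
      push_cast
      field_simp
    rw [ArithOp.ratValue, e]
    refine (ratBits_div_le _ _).trans ?_
    have := Nat.size_le_size habs₁
    simp only [Int.natAbs_mul, Int.natAbs_natCast]
    omega
  | sub =>
    have e : x - y = ((x.num * y.den - y.num * x.den : ℤ) : ℚ) / ((x.den * y.den : ℤ) : ℚ) := by
      conv_lhs => rw [← Rat.num_div_den x, ← Rat.num_div_den y]
      push_cast
      field_simp
    rw [ArithOp.ratValue, e]
    refine (ratBits_div_le _ _).trans ?_
    have := Nat.size_le_size habs₂
    simp only [Int.natAbs_mul, Int.natAbs_natCast]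
    omega
  | mul =>
    have e : x * y = ((x.num * y.num : ℤ) : ℚ) / ((x.den * y.den : ℤ) : ℚ) := by
      conv_lhs => rw [← Rat.num_div_den x, ← Rat.num_div_den y]
      push_cast
      field_simp
    rw [ArithOp.ratValue, e]
    refine (ratBits_div_le _ _).trans ?_
    simp only [Int.natAbs_mul, Int.natAbs_natCast]
    omega
  | div =>
    have e : x / y = ((x.num * y.den : ℤ) : ℚ) / ((x.den * y.num : ℤ) : ℚ) := by
      conv_lhs => rw [← Rat.num_div_den x, ← Rat.num_div_den y]
      push_cast
      rw [div_div_div_eq]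
    rw [ArithOp.ratValue, e]
    refine (ratBits_div_le _ _).trans ?_
    simp only [Int.natAbs_mul, Int.natAbs_natCast]
    omega

theorem bitLength_ratCast (r : ℚ) : bitLength (r : ℝ) = ratBits r := by
  have h : ∃ r' : ℚ, (r' : ℝ) = r := ⟨r, rfl⟩
  rw [bitLength, dif_pos h]
  congr 1
  exact_mod_cast h.choose_spec

theorem IsRationalOfLength.mono {L L' : ℕ} {x : ℝ} (h : IsRationalOfLength L x) (hL : L ≤ L') :
    IsRationalOfLength L' x := by
  obtain ⟨r, h1, h2⟩ := h
  exact ⟨r, h1, h2.trans hL⟩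

/-- Bit lengths grow by a constant factor with every arithmetic operation. -/
theorem scale_bitLength (L : ℕ) :
    Scale bitLength (6 ^ 12 * (L + 10)) fun d => {x | IsRationalOfLength (6 ^ d * (L + 10)) x} where
  mono d x hx := hx.mono (Nat.mul_le_mul_right _ (Nat.pow_le_pow_right (by omega) (by omega)))
  nat k hk := by
    refine ⟨k, by simp, ?_⟩
    rw [ratBits_natCast]
    -- Nine bits for constants up to `270` and one for the denominator give the `10` in `L + 10`.
    have : Nat.size k ≤ 9 := Nat.size_le.2 (by omega)
    omega
  arith op d x y := by
    rintro ⟨r, rfl, hr⟩ ⟨r', rfl, hr'⟩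
    refine ⟨op.ratValue r r', (op.value_ratCast r r').symm, ?_⟩
    have hl : 2 ≤ 6 ^ d * (L + 10) := by
      have := Nat.one_le_pow d 6 (by omega)
      nlinarith
    refine (op.ratBits_ratValue_le hr hr' hl).trans (le_of_eq ?_)
    rw [pow_succ]; ring
  size_le d x hd := by
    rintro ⟨r, rfl, hr⟩
    rw [bitLength_ratCast]
    exact hr.trans (Nat.mul_le_mul_right _ (Nat.pow_le_pow_right (by omega) hd))

/-- With the size function zero, costs count instructions and arbitrary reals are admitted. -/
theorem scale_zero : Scale 0 0 fun _ => Set.univ where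
  mono _ := subset_rfl
  nat _ _ := Set.mem_univ _
  arith _ _ _ _ _ _ := Set.mem_univ _
  size_le _ _ _ _ := le_rfl

/-! ## Running time and output of the auction program -/

theorem auctionSteps_le (n m : ℕ) : auctionSteps n m ≤ 500 * (n + m + 1) ^ 3 := by
  unfold auctionSteps
  nlinarith [Nat.zero_le n, Nat.zero_le m, Nat.zero_le (n * m), Nat.zero_le (n * n),
    Nat.zero_le (m * m), Nat.zero_le (n * n * n), Nat.zero_le (m * m * m),
    Nat.zero_le (n * m * m), Nat.zero_le (n * n * m)]

theorem AllocationInstance.n_pos (I : AllocationInstance) : 0 < I.n := by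
  by_contra h
  have h0 : I.n = 0 := by omega
  have hI := I.b_sum
  have : IsEmpty (Fin I.n) := by rw [h0]; infer_instance
  simp at hI

/-- One bound on the number of steps serves both clauses; for the bit cost it is multiplied by the
largest cost of a step. -/
theorem BiddingRule.Correct.runsInPolynomialTime {R : BiddingRule} (hR : R.Correct)
    (K : Set AllocationInstance) : RunsInPolynomialTime R.program K := by
  refine ⟨⟨500 * (Polynomial.X + 1) ^ 3, fun I _ t => ?_⟩,
    ⟨500 * (Polynomial.X + 1) ^ 3 * (1 + 3 * (6 ^ 12 * (Polynomial.X + 10))),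
      fun I _ t L hb ht hv => ?_⟩⟩
  · obtain ⟨k, s, h1, h2, -⟩ := hR.program_spec (I := I) (t := t) scale_zero
      (fun _ => Set.mem_univ _) (fun _ => Set.mem_univ _) (fun _ _ => Set.mem_univ _)
    refine ⟨k, s, h1, h2.trans ?_⟩
    have := auctionSteps_le I.n I.m
    simpa using this
  · obtain ⟨k, s, h1, h2, -⟩ := hR.program_spec (I := I) (t := t) (scale_bitLength L)
      (fun i => (hb i).mono (by omega)) (fun i => (ht i).mono (by omega))
      (fun i S => (hv i S).mono (by omega))
    refine ⟨k, s, h1, h2.trans ?_⟩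
    have h3 : auctionSteps I.n I.m ≤ 500 * (I.n + I.m + L + 1) ^ 3 :=
      (auctionSteps_le _ _).trans (Nat.mul_le_mul_left _ (Nat.pow_le_pow_left (by omega) 3))
    have h4 : 1 + 3 * (6 ^ 12 * (L + 10)) ≤ 1 + 3 * (6 ^ 12 * (I.n + I.m + L + 10)) := by omega
    simpa using Nat.mul_le_mul h3 h4

theorem BiddingRule.Correct.isConditionalAlgorithm {R : BiddingRule} (hR : R.Correct)
    (K : Set AllocationInstance) (share ρ : (I : AllocationInstance) → Fin I.n → ℝ)
    (hK : K ⊆ submodularInstances)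
    (h : ∀ I ∈ K, ∀ (t : Fin I.n → ℝ) o π, Auction (R.Active I t) (R.bid I t) I.m o π →
      ∀ i, t i ≤ share I i → ρ I i * t i ≤ I.v i (held o i)) :
    IsConditionalAlgorithm R.program K share ρ := by
  intro I hI t
  obtain ⟨k, s, h1, -, o, π, h2, h3⟩ := hR.program_spec (I := I) (t := t) scale_zero
    (fun _ => Set.mem_univ _) (fun _ => Set.mem_univ _) (fun _ _ => Set.mem_univ _)
  -- Unsold items keep the default entry `0` of the output array and so go to agent `0`; by
  -- monotonicity extra items do no harm.
  refine ⟨fun j => (o j).getD ⟨0, I.n_pos⟩, ⟨k, s, h1, fun j => ?_⟩, fun i hi => ?_⟩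
  · rw [(h3 j).2]
    cases ho : o j <;> simp [ho]
  · refine (h I hI t o π h2 i hi).trans ((hK hI i).mono _ _ fun j hj => ?_)
    rw [mem_held] at hj
    simp [bundle, hj]

theorem apsRule_guarantee {I : AllocationInstance} (hI : I ∈ submodularInstances)
    {t : Fin I.n → ℝ} {o : Fin I.m → Option (Fin I.n)} {π : Fin I.m → ℝ}
    (h : Auction (apsRule.Active I t) (apsRule.bid I t) I.m o π) (i : Fin I.n)
    (hi : t i ≤ anyPriceShare (I.b i) (I.v i)) :
    1 / (3 - 2 * I.b i) * t i ≤ I.v i (held o i) := by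
  have hb1 : I.b i ≤ 1 := by
    rw [← I.b_sum]
    exact Finset.single_le_sum (fun k _ => (I.b_pos k).le) (Finset.mem_univ i)
  have hpos : 0 < 3 - 2 * I.b i := by linarith
  have hgoal : 1 / (3 - 2 * I.b i) * t i = t i / (3 - 2 * I.b i) := by ring
  rw [hgoal]
  refine h.aps_guarantee (hI i) (I.b_pos i) hb1 (fun _ => Iff.rfl) (fun _ _ => rfl)
    (β := I.b) (fun k => h.aps_payment_le (hI k) (I.b_pos k) (fun _ => Iff.rfl) fun _ _ => rfl)
    ?_ ?_
  · have := Finset.add_sum_erase Finset.univ I.b (Finset.mem_univ i)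
    rw [I.b_sum] at this
    linarith
  · rwa [mul_div_cancel₀ _ hpos.ne']

theorem maximinShare_const_mul {n m : ℕ} {v : Finset (Fin m) → ℝ} {a : ℝ} (ha : 0 ≤ a) :
    maximinShare n (fun S => a * v S) = a * maximinShare n v := by
  unfold maximinShare
  rw [Real.mul_iSup_of_nonneg ha]
  simp_rw [Real.mul_iInf_of_nonneg ha]

/-- After scaling the valuation of each agent `k` with `t k > 0` by `27 / t k`, the rule is the one
analyzed above, and the share of agent `i` becomes at least `27`. Agents with `t k ≤ 0` are never
active, so they fit into any budget. -/
theorem mmsRule_guarantee {I : AllocationInstance} (hI : I ∈ submodularInstances)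
    (hI' : I ∈ equalEntitlementInstances)
    {t : Fin I.n → ℝ} {o : Fin I.m → Option (Fin I.n)} {π : Fin I.m → ℝ}
    (h : Auction (mmsRule.Active I t) (mmsRule.bid I t) I.m o π) (i : Fin I.n)
    (hi : t i ≤ maximinShare I.n (I.v i)) :
    (10 / 27 + 1 / 270 / (I.n : ℝ)) * t i ≤ I.v i (held o i) := by
  have hn := I.n_pos
  have hn' : (0 : ℝ) < I.n := by exact_mod_cast hn
  set ρ : ℝ := 10 + 1 / (10 * I.n) with hρ
  have hρ10 : 10 ≤ ρ := by
    have : 0 < 1 / (10 * (I.n : ℝ)) := by positivity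
    linarith
  have hact : ∀ k, 0 < t k → ∀ A, mmsRule.Active I t k A ↔ 27 / t k * I.v k A < ρ := by
    intro k hk A
    change I.v k A < (10 / 27 + I.b k / 270) * t k ↔ _
    rw [hI' k, div_mul_eq_mul_div, div_lt_iff₀ hk]
    have : (10 / 27 + 1 / (I.n : ℝ) / 270) * t k = ρ * t k / 27 := by
      rw [hρ]; field_simp; ring
    rw [this, lt_div_iff₀ (by norm_num), mul_comm]
  have hbid : ∀ k A j, mmsRule.bid I t k A j = mmsBid ρ A.card (27 / t k * I.v k A)
      (marginal (fun S => 27 / t k * I.v k S) A j) := by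
    intro k A j
    change mmsBid (10 + I.b k / 10) A.card (27 * I.v k A / t k)
      (27 * marginal (I.v k) A j / t k) = _
    have h1 : 10 + I.b k / 10 = ρ := by
      rw [hI' k, hρ]; field_simp
    have h2 : 27 * marginal (I.v k) A j / t k = marginal (fun S => 27 / t k * I.v k S) A j := by
      unfold marginal; ring
    rw [h1, h2, mul_div_right_comm]
  have hsub : ∀ k, 0 < t k → IsSubmodularValuation fun S => 27 / t k * I.v k S :=
    fun k hk => (hI k).const_mul (by positivity)
  rcases le_or_gt (t i) 0 with hti | hti
  · refine le_trans (mul_nonpos_of_nonneg_of_nonpos (by positivity) hti) ((hI i).nonneg _)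
  have hβ : ∀ k, ∑ j ∈ held o k, π j ≤ 7 / 4 * ρ - 7 / 2 := by
    intro k
    rcases le_or_gt (t k) 0 with htk | htk
    · rw [h.held_eq_empty fun A hA => ?_]
      · rw [Finset.sum_empty]; linarith
      · change I.v k A < (10 / 27 + I.b k / 270) * t k at hA
        have h1 := (hI k).nonneg A
        have h2 := I.b_pos k
        have h3 : (10 / 27 + I.b k / 270) * t k ≤ 0 :=
          mul_nonpos_of_nonneg_of_nonpos (by positivity) htk
        linarith
    · exact h.mms_payment_le (hsub k htk) hρ10 (hact k htk) (hbid k)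
  have key := h.mms_guarantee (hsub i hti) hn hρ (hact i hti) (hbid i) hβ (by
    rw [maximinShare_const_mul (by positivity), div_mul_eq_mul_div, le_div_iff₀ hti]
    linarith)
  rw [div_mul_eq_mul_div, le_div_iff₀ hti] at key
  have h1 : (10 / 27 + 1 / 270 / (I.n : ℝ)) * t i = ρ * t i / 27 := by
    rw [hρ]; field_simp; ring
  rw [h1]
  linarith

end FairAllocation

theorem mainTheorem9 :
    (∃ P : FairAllocation.Program,
      FairAllocation.RunsInPolynomialTime P FairAllocation.submodularInstances ∧
      FairAllocation.IsConditionalAlgorithm P FairAllocation.submodularInstances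
        (fun I i => FairAllocation.anyPriceShare (I.b i) (I.v i))
        (fun I i => 1 / (3 - 2 * I.b i))) ∧
    (∃ c : ℝ, 0 < c ∧ ∃ P : FairAllocation.Program,
      FairAllocation.RunsInPolynomialTime P
        (FairAllocation.submodularInstances ∩ FairAllocation.equalEntitlementInstances) ∧
      FairAllocation.IsConditionalAlgorithm P
        (FairAllocation.submodularInstances ∩ FairAllocation.equalEntitlementInstances)
        (fun I i => FairAllocation.maximinShare I.n (I.v i))
        (fun I _ => 10 / 27 + c / (I.n : ℝ))) := by
  refine ⟨⟨FairAllocation.apsRule.program,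
    FairAllocation.apsRule_correct.runsInPolynomialTime _,
    FairAllocation.apsRule_correct.isConditionalAlgorithm _ _ _ subset_rfl ?_⟩,
    -- The constant comes from `ρ / 27 = 10 / 27 + 1 / (270 * n)`.
    1 / 270, by norm_num, FairAllocation.mmsRule.program,
    FairAllocation.mmsRule_correct.runsInPolynomialTime _,
    FairAllocation.mmsRule_correct.isConditionalAlgorithm _ _ _ Set.inter_subset_left ?_⟩
  · exact fun I hI t o π h i hi => FairAllocation.apsRule_guarantee hI h i hi
  · exact fun I hI t o π h i hi => FairAllocation.mmsRule_guarantee hI.1 hI.2 h i hi
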